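/- A sequence of positive integers may be finite or infinite and may have repeated terms. For such a sequence $A$ and a positive integer $n$, let $|A\cap[n]|$ denote the number of terms of $A$, counted with multiplicity, that lie in $\{1,\dots,n\}$, and let $\Sigma(A)$ be the set of all sums of finitely many terms of $A$ with distinct indices. For an integer $r\ge 2$, the sequence $A$ is called $r$-Ramsey complete if, whenever its terms are partitioned into $r$ (possibly empty) classes $A_1,\dots,A_r$, every sufficiently large positive integer lies in $\Sigma(A_1)\cup\dots\cup\Sigma(A_r)$. Here $\log$ is the natural logarithm. 1. There is an absolute constant $C$ such that, for every integer $r\ge 2$, there is an $r$-Ramsey complete, strictly increasing infinite sequence $A$ of positive integers with $|A\cap[n]|\le C\,r\log^2 n$ for all integers $n\ge 1$. 2. There is an absolute constant $c>0$ such that, for every integer $r\ge 2$, no sequence $A$ of positive integers with $|A\cap[n]|\le c\,r\log^2 n$ for all sufficiently large $n$ is $r$-Ramsey complete. 3. More explicitly, for every integer $r\ge 2$, no sequence $A$ of positive integers with $|A\cap[n]|\le \frac{r-1}{140}(\log_2 n)^2$ for all sufficiently large $n$ is $r$-Ramsey complete. -/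

import Mathlib

open Filter

/-- A sequence of positive integers, finite or infinite, is a family `a : ι → ℕ` of positive
integers over a countable index type; repetitions are allowed and the order of the terms is
irrelevant. For a class of terms, given by its set `I` of indices, `subsetSums a I` is the set
of all sums of finitely many terms of the class with distinct indices. -/
def subsetSums {ι : Type*} (a : ι → ℕ) (I : Set ι) : Set ℕ :=
  {m | ∃ S : Finset ι, (S : Set ι) ⊆ I ∧ ∑ i ∈ S, a i = m}

/-- The sequence `a` is `r`-Ramsey complete: for every partition of its terms into `r` classes
(the fibres of a colouring `χ`; classes may be empty), every sufficiently large integer is a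
subset sum of one of the classes. -/
def IsRamseyComplete {ι : Type*} (r : ℕ) (a : ι → ℕ) : Prop :=
  ∀ χ : ι → Fin r, ∀ᶠ m : ℕ in atTop, m ∈ ⋃ k : Fin r, subsetSums a (χ ⁻¹' {k})

/-- `|A ∩ [n]| ≤ x`, where terms of the sequence are counted with multiplicity. Finiteness is
part of the condition because `Set.ncard` of an infinite set is `0`. -/
def CountLE {ι : Type*} (a : ι → ℕ) (n : ℕ) (x : ℝ) : Prop :=
  {i | a i ∈ Set.Icc 1 n}.Finite ∧ ({i | a i ∈ Set.Icc 1 n}.ncard : ℝ) ≤ x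

/-! Lower bound. At a scale m = 2 ^ K, call a term a small if l * a ≤ m, where l is proportional to
log m, and large otherwise. Half of the colours are reserved for small terms, the other half for
large ones. If the small terms are spread evenly, each small class has too small a total to reach
(7m/8, m]. If the large terms are spread evenly, an exponential moment bound shows that each large
class has far fewer than m / r subsets with sum at most m. Hence some number in (7m/8, m] is missed.
With x = l * a / m, both requirements are controlled by the weight min x x⁻¹: it equals x on small
terms and bounds exp (-x) on large ones. Each term has total weight O(1) over all dyadic scales, so
by averaging a sequence with few terms has a scale of small total weight. Finitely many earlier
terms of arbitrary colour do no harm, so one colouring can miss a number in each of infinitely many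
windows (`exists_window_colouring`).

Upper bound. For each large k take a block of 40rk numbers 1 + Qv, where v runs over a random-like
subset of [2^k, 2^(k+1)). Every r-colouring puts 40k of them in one class, and any 40k of them
represent the whole interval [14kQ2^k, 29kQ2^k]; these intervals overlap for consecutive k. To
obtain the interval, let X be the set of sums of a subset T. Adding v enlarges X by its shift
defect, the number of elements that leave X under the shift by 1 + Qv. Genericity of the block lets
X grow geometrically until a positive proportion of all v have small defect, and the trivial bound
on |X| forces this within 3k steps (`exists_subset_many_small_defects`). Differences of such v then
make X almost invariant under all short multiples of D = Q², where Q is a factorial. So X contains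
most of a long progression of difference D. Two disjoint such T give a full progression, congruent
terms coprime to D fill in the residues, and the remaining terms lengthen the resulting interval. -/

/-! ### Lower bound: balancing and counting subset sums -/

/-- A finite family of weights in `[0, 1]` can be split into `q` classes of nearly equal weight. -/
lemma exists_balanced_colouring {ι : Type*} [DecidableEq ι] (h : ι → ℝ) {q : ℕ} (hq : 0 < q)
    (s : Finset ι) (h0 : ∀ i ∈ s, 0 ≤ h i) (h1 : ∀ i ∈ s, h i ≤ 1) :
    ∃ c : ι → Fin q, ∀ k, ∑ i ∈ s with c i = k, h i ≤ (∑ i ∈ s, h i) / q + 1 := by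
  induction s using Finset.induction_on with
  | empty => exact ⟨fun _ => ⟨0, hq⟩, fun k => by simp⟩
  | insert j s hj ih =>
    obtain ⟨c, hc⟩ := ih (fun i hi => h0 i (Finset.mem_insert_of_mem hi))
      (fun i hi => h1 i (Finset.mem_insert_of_mem hi))
    have hq' : (0 : ℝ) < q := by exact_mod_cast hq
    have hj0 := h0 j (Finset.mem_insert_self _ _)
    have hj1 := h1 j (Finset.mem_insert_self _ _)
    -- The new element joins a class of at most average weight, so that class ends at most 1 above
    -- the average.
    obtain ⟨k₀, hk₀⟩ : ∃ k₀, ∑ i ∈ s with c i = k₀, h i ≤ (∑ i ∈ s, h i) / q := by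
      have : Nonempty (Fin q) := ⟨⟨0, hq⟩⟩
      have := Finset.exists_le_of_sum_le (s := (Finset.univ : Finset (Fin q)))
        (f := fun k => ∑ i ∈ s with c i = k, h i) (g := fun _ => (∑ i ∈ s, h i) / q)
        Finset.univ_nonempty (by
          rw [Finset.sum_fiberwise]
          simp
          field_simp
          exact le_rfl)
      obtain ⟨k, -, hk⟩ := this
      exact ⟨k, hk⟩
    have hmono : (∑ i ∈ s, h i) / q ≤ (∑ i ∈ insert j s, h i) / q := by
      rw [Finset.sum_insert hj]
      gcongr
      linarith
    refine ⟨Function.update c j k₀, fun k => ?_⟩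
    have hs : ∀ k, {i ∈ s | Function.update c j k₀ i = k} = {i ∈ s | c i = k} := by
      intro k
      apply Finset.filter_congr
      intro i hi
      rw [Function.update_of_ne (by rintro rfl; exact hj hi)]
    rw [Finset.filter_insert, Function.update_self, hs]
    split_ifs with hk
    · subst hk
      rw [Finset.sum_insert (by simp [hj])]
      linarith
    · linarith [hc k]

/-- An exponential moment bound for the number of subsets with bounded sum. -/
lemma card_subsets_sum_le {ι : Type*} [DecidableEq ι] (a : ι → ℕ) (T : Finset ι) {m : ℕ}
    (hm : 0 < m) {l : ℝ} (hl : 0 ≤ l) :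
    (({S ∈ T.powerset | ∑ i ∈ S, a i ≤ m} : Finset (Finset ι)).card : ℝ) ≤
      Real.exp (l + ∑ i ∈ T, Real.exp (-(l * a i / m))) := by
  have hm' : (0 : ℝ) < m := by exact_mod_cast hm
  calc (({S ∈ T.powerset | ∑ i ∈ S, a i ≤ m} : Finset (Finset ι)).card : ℝ)
      = ∑ S ∈ T.powerset with ∑ i ∈ S, a i ≤ m, (1 : ℝ) := by simp
    -- Each counted S has weight at least 1, because its sum is at most m; afterwards the
    -- restriction on S is dropped and the sum factorises.
    _ ≤ ∑ S ∈ T.powerset with ∑ i ∈ S, a i ≤ m,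
          Real.exp l * ∏ i ∈ S, Real.exp (-(l * a i / m)) := by
        apply Finset.sum_le_sum
        intro S hS
        rw [Finset.mem_filter] at hS
        rw [← Real.exp_sum, ← Real.exp_add, Real.one_le_exp_iff, Finset.sum_neg_distrib,
          ← Finset.sum_div, ← Finset.mul_sum]
        have h2 : (∑ i ∈ S, (a i : ℝ)) ≤ m := by exact_mod_cast hS.2
        have h3 : l * (∑ i ∈ S, (a i : ℝ)) / m ≤ l := by
          rw [div_le_iff₀ hm']
          exact mul_le_mul_of_nonneg_left h2 hl
        linarith
    _ ≤ ∑ S ∈ T.powerset, Real.exp l * ∏ i ∈ S, Real.exp (-(l * a i / m)) :=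
        Finset.sum_le_sum_of_subset_of_nonneg (Finset.filter_subset _ _)
          (fun _ _ _ => mul_nonneg (Real.exp_nonneg _)
            (Finset.prod_nonneg fun _ _ => Real.exp_nonneg _))
    _ = Real.exp l * ∏ i ∈ T, (1 + Real.exp (-(l * a i / m))) := by
        rw [Finset.prod_one_add, Finset.mul_sum]
    _ ≤ Real.exp l * ∏ i ∈ T, Real.exp (Real.exp (-(l * a i / m))) := by
        gcongr with i hi
        rw [add_comm]
        exact Real.add_one_le_exp _
    _ = _ := by rw [← Real.exp_sum, ← Real.exp_add]

/-! ### Lower bound: averaging over dyadic scales -/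

/-- A potential for `min x x⁻¹` along dyadic scales. -/
noncomputable def dyadicPotential (x : ℝ) : ℝ := if x ≤ 1 then x else 3 - 2 / x

lemma dyadicPotential_nonneg {x : ℝ} (hx : 0 < x) : 0 ≤ dyadicPotential x := by
  unfold dyadicPotential
  split_ifs with h
  · exact hx.le
  · have : 2 / x ≤ 2 := by rw [div_le_iff₀ hx]; linarith
    linarith

lemma dyadicPotential_le {x : ℝ} (hx : 0 < x) : dyadicPotential x ≤ 3 := by
  unfold dyadicPotential
  split_ifs with h
  · linarith
  · have : 0 ≤ 2 / x := by positivity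
    linarith

lemma min_inv_le_dyadicPotential_sub {x : ℝ} (hx : 0 < x) :
    min x x⁻¹ ≤ dyadicPotential (2 * x) - dyadicPotential x := by
  unfold dyadicPotential
  split_ifs with h1 h2 h2
  · exact (min_le_left _ _).trans (by linarith)
  · linarith
  · refine (min_le_left _ _).trans ?_
    have : 2 / (2 * x) ≤ 3 - 2 * x := by
      rw [div_le_iff₀ (by positivity)]
      nlinarith
    linarith
  · refine (min_le_right _ _).trans (le_of_eq ?_)
    field_simp
    ring

/-- Halving the argument makes the sum telescope in the potential, whose values lie in [0, 3]. -/
lemma sum_min_inv_dyadic_le {u : ℝ} (hu : 0 < u) (M N : ℕ) :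
    ∑ K ∈ Finset.Ioc M N, min (u / 2 ^ K) (u / 2 ^ K)⁻¹ ≤ 3 := by
  have key : ∀ n, ∑ j ∈ Finset.range n, min (u / 2 ^ (M + 1 + j)) (u / 2 ^ (M + 1 + j))⁻¹ ≤
      dyadicPotential (u / 2 ^ M) - dyadicPotential (u / 2 ^ (M + n)) := by
    intro n
    induction n with
    | zero => simp
    | succ n ih =>
      rw [Finset.sum_range_succ]
      have h := min_inv_le_dyadicPotential_sub (x := u / 2 ^ (M + 1 + n)) (by positivity)
      have e : 2 * (u / 2 ^ (M + 1 + n)) = u / 2 ^ (M + n) := by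
        field_simp
        ring
      rw [e] at h
      have e2 : M + (n + 1) = M + 1 + n := by ring
      rw [e2]
      linarith
  have h := key (N - M)
  have e : ∑ K ∈ Finset.Ioc M N, min (u / 2 ^ K) (u / 2 ^ K)⁻¹ =
      ∑ j ∈ Finset.range (N - M), min (u / 2 ^ (M + 1 + j)) (u / 2 ^ (M + 1 + j))⁻¹ := by
    rw [← Finset.Ico_add_one_add_one_eq_Ioc, Finset.sum_Ico_eq_sum_range]
    congr 2
    omega
  rw [e]
  have h1 := dyadicPotential_le (x := u / 2 ^ M) (by positivity)
  have h2 := dyadicPotential_nonneg (x := u / 2 ^ (M + (N - M))) (by positivity)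
  linarith

/-- Once B < N / 4 the exponent is below (1/4 + 6/35 + 1/4) N, and this coefficient is less than log
2. -/
lemma eventually_exp_lt_two_pow (B : ℝ) :
    ∀ᶠ N : ℕ in atTop, Real.exp ((N : ℝ) / 4 + 6 / 35 * N + B) < 2 ^ N := by
  filter_upwards [(tendsto_natCast_atTop_atTop (R := ℝ)).eventually_gt_atTop (4 * B)] with N hN
  have h2 : (2 : ℝ) ^ N = Real.exp (N * Real.log 2) := by
    rw [mul_comm, Real.exp_mul, Real.exp_log (by norm_num), Real.rpow_natCast]
  rw [h2, Real.exp_lt_exp]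
  have := Real.log_two_gt_d9
  have hN0 : (0 : ℝ) ≤ N := Nat.cast_nonneg _
  nlinarith

/-- At most scales the terms of a sparse sequence have small total weight. -/
lemma exists_scale_of_countLE {ι : Type*} (a : ι → ℕ) (ha : ∀ i, 0 < a i) {R : ℝ}
    (I : ℕ → Finset ι) (hI : ∀ n i, i ∈ I n ↔ a i ≤ n) {N : ℕ} (hN : 0 < N)
    (hcard : ((I (2 ^ (2 * N))).card : ℝ) ≤ R * (2 * N) ^ 2) {l : ℝ} (hl : 0 < l) :
    ∃ K, N < K ∧ K ≤ 2 * N ∧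
      ∑ i ∈ I (2 ^ K), min (l * a i / 2 ^ K) (l * a i / 2 ^ K)⁻¹ ≤ 12 * R * N := by
  have hN' : (0 : ℝ) < N := by exact_mod_cast hN
  have hpos : ∀ i, 0 < l * a i := fun i => mul_pos hl (by exact_mod_cast ha i)
  -- Exchanging the sums, each of the at most 4RN² terms costs 3 in total, while there are N scales.
  have hsum : ∑ K ∈ Finset.Ioc N (2 * N), ∑ i ∈ I (2 ^ K),
      min (l * a i / 2 ^ K) (l * a i / 2 ^ K)⁻¹ ≤
      ∑ K ∈ Finset.Ioc N (2 * N), 12 * R * N := by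
    calc _ ≤ ∑ K ∈ Finset.Ioc N (2 * N), ∑ i ∈ I (2 ^ (2 * N)),
        min (l * a i / 2 ^ K) (l * a i / 2 ^ K)⁻¹ := by
          apply Finset.sum_le_sum
          intro K hK
          rw [Finset.mem_Ioc] at hK
          apply Finset.sum_le_sum_of_subset_of_nonneg
          · intro i hi
            rw [hI] at hi ⊢
            exact hi.trans (Nat.pow_le_pow_right (by norm_num) hK.2)
          · intro i _ _
            have := hpos i
            positivity
      _ = ∑ i ∈ I (2 ^ (2 * N)), ∑ K ∈ Finset.Ioc N (2 * N),
        min (l * a i / 2 ^ K) (l * a i / 2 ^ K)⁻¹ := Finset.sum_comm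
      _ ≤ ∑ i ∈ I (2 ^ (2 * N)), 3 :=
          Finset.sum_le_sum fun i _ => sum_min_inv_dyadic_le (hpos i) _ _
      _ = 3 * (I (2 ^ (2 * N))).card := by rw [Finset.sum_const, nsmul_eq_mul, mul_comm]
      _ ≤ 3 * (R * (2 * N) ^ 2) := by gcongr
      _ = _ := by
          rw [Finset.sum_const, Nat.card_Ioc, nsmul_eq_mul, two_mul N, Nat.add_sub_cancel]
          ring
  obtain ⟨K, hK, h⟩ := Finset.exists_le_of_sum_le ⟨2 * N, by simp; omega⟩ hsum
  rw [Finset.mem_Ioc] at hK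
  exact ⟨K, hK.1, hK.2, h⟩

/-! ### Lower bound: the colouring of one window and of all terms -/

/-- The terms in a suitable window `(m₀, m₁]` can be coloured so that some number in this window
is missed, whatever the colours of the other terms are. -/
lemma exists_window_colouring {ι : Type*} (a : ι → ℕ) (ha : ∀ i, 0 < a i) {r : ℕ} (hr : 2 ≤ r)
    (hA : ∀ᶠ n : ℕ in atTop, CountLE a n (((r : ℝ) - 1) / 140 * Real.logb 2 n ^ 2)) (m₀ : ℕ) :
    ∃ m₁ > m₀, ∃ χ₁ : ι → Fin r, ∃ z, m₀ < z ∧ ∀ χ : ι → Fin r,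
      (∀ i, m₀ < a i → a i ≤ m₁ → χ i = χ₁ i) → z ∉ ⋃ k : Fin r, subsetSums a (χ ⁻¹' {k}) := by
  classical
  have hfin : ∀ n, {i | a i ≤ n}.Finite := by
    intro n
    obtain ⟨N, hN⟩ := (hA.and (eventually_ge_atTop n)).exists
    exact hN.1.1.subset fun i hi => ⟨ha i, le_trans hi hN.2⟩
  set I : ℕ → Finset ι := fun n => (hfin n).toFinset with hIdef
  have hI : ∀ n i, i ∈ I n ↔ a i ≤ n := fun n i => by simp [hIdef]
  have hIcard : ∀ᶠ n : ℕ in atTop,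
      ((I n).card : ℝ) ≤ ((r : ℝ) - 1) / 140 * Real.logb 2 n ^ 2 := by
    filter_upwards [hA] with n hn
    have : ({i | a i ∈ Set.Icc 1 n}.ncard) = (I n).card := by
      rw [← Set.ncard_coe_finset]
      congr 1
      ext i
      simp [hI, Nat.succ_le_iff, ha i]
    rw [← this]
    exact hn.2
  set s₀ := ∑ i ∈ I m₀, a i with hs₀
  -- Numbers of colours for small and for large terms; each is at least (r - 1) / 2.
  set r₁ := r / 2 with hr₁
  set r₂ := r - r / 2 with hr₂
  have hr₁0 : 0 < r₁ := by omega
  have hr₂0 : 0 < r₂ := by omega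
  have hr₁' : ((r : ℝ) - 1) / 2 ≤ r₁ := by
    have : r ≤ 2 * r₁ + 1 := by omega
    have : (r : ℝ) ≤ 2 * r₁ + 1 := by exact_mod_cast this
    linarith
  have hr₂' : ((r : ℝ) - 1) / 2 ≤ r₂ := by
    have : r ≤ 2 * r₂ + 1 := by omega
    have : (r : ℝ) ≤ 2 * r₂ + 1 := by exact_mod_cast this
    linarith
  have htend : Tendsto (fun N : ℕ => 2 ^ (2 * N)) atTop atTop :=
    (tendsto_pow_atTop_atTop_of_one_lt (by norm_num : 1 < 2)).comp
      (tendsto_id.const_mul_atTop' (by norm_num))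
  have htend' : Tendsto (fun N : ℕ => 2 ^ N) atTop atTop :=
    tendsto_pow_atTop_atTop_of_one_lt (by norm_num : 1 < 2)
  obtain ⟨N, hN1, hN2, hN3, hN4⟩ := ((htend.eventually hIcard).and
    ((eventually_exp_lt_two_pow ((I m₀).card + 1 + Real.log (8 * r))).and
      ((eventually_ge_atTop 64).and
        (htend'.eventually_ge_atTop (8 * (s₀ + m₀ + 1)))))).exists
  have hN0 : (0 : ℝ) < N := by exact_mod_cast (by omega : 0 < N)
  have hr0 : (0 : ℝ) < r := by exact_mod_cast (by omega : 0 < r)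
  have hr1 : (0 : ℝ) < (r : ℝ) - 1 := by
    have : (2 : ℝ) ≤ r := by exact_mod_cast hr
    linarith
  obtain ⟨K, hNK, -, hG⟩ := exists_scale_of_countLE a ha (R := ((r : ℝ) - 1) / 140) I hI
    (by omega : 0 < N) (by
      refine hN1.trans_eq ?_
      congr 2
      push_cast
      rw [Real.logb_pow, Real.logb_self_eq_one (by norm_num)]
      push_cast
      ring) (l := (N : ℝ) / 4) (by positivity)
  -- The choice N / 4 serves both sides: 6N/35 + 1 ≤ (3/4) l once N ≥ 64, and l + 6N/35 stays well
  -- below N log 2.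
  set l : ℝ := (N : ℝ) / 4 with hl
  have hl0 : 0 < l := by positivity
  set m := 2 ^ K with hm
  have hmR : ((2 : ℝ) ^ K) = (m : ℝ) := by simp [hm]
  have hm0 : 0 < m := by positivity
  have hmR0 : (0 : ℝ) < m := by exact_mod_cast hm0
  have hNm : 2 ^ N ≤ m := Nat.pow_le_pow_right (by norm_num) hNK.le
  rw [hmR] at hG
  set h : ι → ℝ := fun i => min (l * a i / m) (l * a i / m)⁻¹ with hh
  have hpos : ∀ i, 0 < l * a i / m := fun i =>
    div_pos (mul_pos hl0 (by exact_mod_cast ha i)) hmR0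
  have h0 : ∀ i, 0 ≤ h i := fun i => by
    have := hpos i
    simp only [hh]
    positivity
  have h1 : ∀ i, h i ≤ 1 := fun i => by
    rcases le_total (l * a i / m) 1 with h' | h'
    · exact (min_le_left _ _).trans h'
    · exact (min_le_right _ _).trans (inv_le_one_of_one_le₀ h')
  obtain ⟨c₁, hc₁⟩ := exists_balanced_colouring h hr₁0 {i ∈ I m | l * a i / m ≤ 1}
    (fun i _ => h0 i) (fun i _ => h1 i)
  obtain ⟨c₂, hc₂⟩ := exists_balanced_colouring h hr₂0 {i ∈ I m | ¬ l * a i / m ≤ 1}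
    (fun i _ => h0 i) (fun i _ => h1 i)
  have hbound : ∀ (q : ℕ) (p : ι → Prop) [DecidablePred p], ((r : ℝ) - 1) / 2 ≤ q →
      (∑ i ∈ I m with p i, h i) / q ≤ 6 / 35 * N := by
    intro q p _ hq
    have hq0 : (0 : ℝ) < q := by linarith
    rw [div_le_iff₀ hq0]
    calc ∑ i ∈ I m with p i, h i ≤ ∑ i ∈ I m, h i :=
          Finset.sum_le_sum_of_subset_of_nonneg (Finset.filter_subset _ _) fun i _ _ => h0 i
      _ ≤ 12 * (((r : ℝ) - 1) / 140) * N := hG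
      _ = 6 / 35 * N * (((r : ℝ) - 1) / 2) := by ring
      _ ≤ _ := by gcongr
  -- The terms up to m₀ have unknown colours, so they are added to every large class; they cost only
  -- a bounded factor.
  set T : Fin r₂ → Finset ι := fun k => I m₀ ∪ {i ∈ {i ∈ I m | ¬ l * a i / m ≤ 1} | c₂ i = k}
    with hT
  have hTcard : ∀ k, (({S ∈ (T k).powerset | ∑ i ∈ S, a i ≤ m} : Finset (Finset ι)).card : ℝ) ≤
      Real.exp (N / 4 + 6 / 35 * N + ((I m₀).card + 1)) := by
    intro k
    refine (card_subsets_sum_le a (T k) hm0 hl0.le).trans ?_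
    rw [Real.exp_le_exp]
    have e1 : ∑ i ∈ T k, Real.exp (-(l * a i / m)) ≤ ∑ i ∈ I m₀, Real.exp (-(l * a i / m)) +
        ∑ i ∈ {i ∈ I m | ¬ l * a i / m ≤ 1} with c₂ i = k, Real.exp (-(l * a i / m)) := by
      rw [← Finset.sum_union_inter]
      exact le_add_of_nonneg_right (Finset.sum_nonneg fun _ _ => Real.exp_nonneg _)
    have e2 : ∑ i ∈ I m₀, Real.exp (-(l * a i / m)) ≤ (I m₀).card := by
      rw [Finset.cast_card]
      apply Finset.sum_le_sum
      intro i _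
      rw [Real.exp_le_one_iff]
      linarith [hpos i]
    -- For x > 1 the weight is 1 / x, which bounds exp (-x).
    have e3 : ∑ i ∈ {i ∈ I m | ¬ l * a i / m ≤ 1} with c₂ i = k, Real.exp (-(l * a i / m)) ≤
        ∑ i ∈ {i ∈ I m | ¬ l * a i / m ≤ 1} with c₂ i = k, h i := by
      apply Finset.sum_le_sum
      intro i hi
      simp only [Finset.mem_filter, not_le] at hi
      have hx := hi.1.2
      have hx' : (l * a i / m)⁻¹ ≤ l * a i / m := (inv_le_one_of_one_le₀ hx.le).trans hx.le
      simp only [hh]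
      rw [min_eq_right hx', Real.exp_neg]
      apply inv_anti₀ (hpos i)
      linarith [Real.add_one_le_exp (l * a i / m)]
    have e4 := hc₂ k
    have e5 := hbound r₂ (fun i => ¬ l * a i / m ≤ 1) hr₂'
    linarith
  set Bad : Finset ℕ := Finset.univ.biUnion fun k =>
    ({S ∈ (T k).powerset | ∑ i ∈ S, a i ≤ m} : Finset (Finset ι)).image fun S => ∑ i ∈ S, a i
    with hBad
  have hBadcard : (Bad.card : ℝ) < m / 8 := by
    have h8 : (0 : ℝ) < 8 * r := by positivity
    calc (Bad.card : ℝ) ≤ ∑ k : Fin r₂,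
          (({S ∈ (T k).powerset | ∑ i ∈ S, a i ≤ m} : Finset (Finset ι)).card : ℝ) := by
          norm_cast
          exact Finset.card_biUnion_le.trans (Finset.sum_le_sum fun k _ => Finset.card_image_le)
      _ ≤ ∑ k : Fin r₂, Real.exp (N / 4 + 6 / 35 * N + ((I m₀).card + 1)) :=
          Finset.sum_le_sum fun k _ => hTcard k
      _ = r₂ * Real.exp (N / 4 + 6 / 35 * N + ((I m₀).card + 1)) := by simp
      _ ≤ r * Real.exp (N / 4 + 6 / 35 * N + ((I m₀).card + 1)) := by
          gcongr
          omega
      _ = Real.exp (N / 4 + 6 / 35 * N + ((I m₀).card + 1 + Real.log (8 * r))) / 8 := by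
          rw [← add_assoc _ _ (Real.log _), Real.exp_add _ (Real.log _), Real.exp_log h8]
          ring
      _ < 2 ^ N / 8 := by gcongr
      _ ≤ m / 8 := by
          gcongr
          exact_mod_cast hNm
  have h8m : 8 ∣ m := by
    rw [hm]
    exact pow_dvd_pow 2 (by omega : 3 ≤ K)
  obtain ⟨m', hm'⟩ := h8m
  have hm'R : (m : ℝ) = 8 * m' := by exact_mod_cast hm'
  -- Fewer than m / 8 numbers are sums of large classes, so the top eighth of [1, m] contains one
  -- that is not.
  obtain ⟨z, hz, hzB⟩ : ∃ z ∈ Finset.Ioc (7 * m') m, z ∉ Bad := by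
    apply Finset.exists_mem_notMem_of_card_lt_card
    rw [Nat.card_Ioc]
    have : (Bad.card : ℝ) < m' := by linarith
    have : Bad.card < m' := by exact_mod_cast this
    omega
  rw [Finset.mem_Ioc] at hz
  have hs₀m : s₀ + m₀ + 1 ≤ m' := by omega
  refine ⟨m, by omega, fun i => if l * a i / m ≤ 1 then ⟨c₁ i, by omega⟩ else
    ⟨r₁ + c₂ i, by omega⟩, z, by omega, ?_⟩
  intro χ hχ hzmem
  simp only [Set.mem_iUnion] at hzmem
  obtain ⟨k, S, hS, hSz⟩ := hzmem
  have hSm : ∀ i ∈ S, a i ≤ m := fun i hi =>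
    (Finset.single_le_sum (f := a) (fun _ _ => Nat.zero_le _) hi).trans (by omega)
  have hSk : ∀ i ∈ S, χ i = k := fun i hi => hS hi
  rcases lt_or_ge k.1 r₁ with hk | hk
  · have hnew : ∀ i ∈ S, m₀ < a i → l * a i / m ≤ 1 ∧ c₁ i = ⟨k.1, hk⟩ := by
      intro i hi hi0
      have e := hχ i hi0 (hSm i hi)
      rw [hSk i hi] at e
      beta_reduce at e
      split_ifs at e with hu
      · exact ⟨hu, Fin.ext (congrArg Fin.val e).symm⟩
      · rw [e] at hk
        simp at hk
    have hsplit := Finset.sum_filter_add_sum_filter_not S (fun i => a i ≤ m₀) a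
    have hold : ∑ i ∈ S with a i ≤ m₀, a i ≤ s₀ := by
      apply Finset.sum_le_sum_of_subset
      intro i hi
      rw [Finset.mem_filter] at hi
      rw [hI]
      exact hi.2
    -- A small colour gets at most 6m/8 from the window and less than m/8 from the older terms, so
    -- it cannot reach z > 7m/8.
    have hnewsum : ((∑ i ∈ S with ¬ a i ≤ m₀, a i : ℕ) : ℝ) ≤ 6 * m' := by
      have e1 : ∑ i ∈ S with ¬ a i ≤ m₀, l * a i / m ≤ 6 / 35 * N + 1 := by
        calc ∑ i ∈ S with ¬ a i ≤ m₀, l * a i / m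
            ≤ ∑ i ∈ {i ∈ I m | l * a i / m ≤ 1} with c₁ i = ⟨k.1, hk⟩, h i := by
              have : ∑ i ∈ S with ¬ a i ≤ m₀, l * a i / m = ∑ i ∈ S with ¬ a i ≤ m₀, h i := by
                apply Finset.sum_congr rfl
                intro i hi
                rw [Finset.mem_filter, not_le] at hi
                have hu := (hnew i hi.1 hi.2).1
                simp only [hh]
                rw [min_eq_left]
                exact hu.trans ((one_le_inv₀ (hpos i)).2 hu)
              rw [this]
              apply Finset.sum_le_sum_of_subset_of_nonneg
              · intro i hi
                rw [Finset.mem_filter, not_le] at hi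
                have hu := hnew i hi.1 hi.2
                simp only [Finset.mem_filter]
                exact ⟨⟨(hI _ _).2 (hSm i hi.1), hu.1⟩, hu.2⟩
              · intro i _ _
                exact h0 i
          _ ≤ (∑ i ∈ I m with l * a i / m ≤ 1, h i) / r₁ + 1 := hc₁ _
          _ ≤ 6 / 35 * N + 1 := by
              gcongr
              exact hbound r₁ (fun i => l * a i / m ≤ 1) hr₁'
      rw [← Finset.sum_div, ← Finset.mul_sum, div_le_iff₀ hmR0] at e1
      push_cast
      have hN64 : (64 : ℝ) ≤ N := by exact_mod_cast hN3
      have e2 : (6 / 35 * (N : ℝ) + 1) ≤ l * (6 / 8) := by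
        rw [hl]
        linarith
      have e3 : l * ∑ i ∈ S with ¬ a i ≤ m₀, (a i : ℝ) ≤ l * (6 * m') := by
        calc _ ≤ (6 / 35 * (N : ℝ) + 1) * m := e1
          _ ≤ l * (6 / 8) * m := by gcongr
          _ = l * (6 * m') := by rw [hm'R]; ring
      exact le_of_mul_le_mul_left e3 hl0
    have hnewsum' : ∑ i ∈ S with ¬ a i ≤ m₀, a i ≤ 6 * m' := by exact_mod_cast hnewsum
    omega
  · apply hzB
    rw [hBad, Finset.mem_biUnion]
    refine ⟨⟨k.1 - r₁, by omega⟩, Finset.mem_univ _, ?_⟩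
    rw [Finset.mem_image]
    refine ⟨S, ?_, hSz⟩
    rw [Finset.mem_filter, Finset.mem_powerset]
    refine ⟨?_, by omega⟩
    intro i hi
    simp only [hT, Finset.mem_union, Finset.mem_filter, hI]
    rcases le_or_gt (a i) m₀ with hi0 | hi0
    · exact Or.inl hi0
    · right
      have e := hχ i hi0 (hSm i hi)
      rw [hSk i hi] at e
      beta_reduce at e
      split_ifs at e with hu
      · rw [e] at hk
        have := (c₁ i).2
        simp at hk
        omega
      · refine ⟨⟨hSm i hi, hu⟩, Fin.ext ?_⟩
        have := congrArg Fin.val e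
        simp only at this ⊢
        omega

/-- The windows (M j, M (j + 1)] partition the positive integers. Each window's colouring works
whatever happens outside it, so all of them can be used at once; the missed numbers exceed M j and
hence are unbounded. -/
theorem not_isRamseyComplete_of_countLE {ι : Type*} (a : ι → ℕ) (ha : ∀ i, 0 < a i) {r : ℕ}
    (hr : 2 ≤ r)
    (hA : ∀ᶠ n : ℕ in atTop, CountLE a n (((r : ℝ) - 1) / 140 * Real.logb 2 n ^ 2)) :
    ¬ IsRamseyComplete r a := by
  classical
  intro hR
  choose next hnext col z hz hmiss using exists_window_colouring a ha hr hA
  set M : ℕ → ℕ := fun j => next^[j] 0 with hM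
  have hMs : ∀ j, M (j + 1) = next (M j) := fun j => Function.iterate_succ_apply' _ _ _
  have hmono : StrictMono M := strictMono_nat_of_lt_succ fun j => by
    rw [hMs]
    exact hnext _
  have hex : ∀ i, ∃ j, a i ≤ M (j + 1) := fun i =>
    ⟨a i, (Nat.le_succ _).trans (hmono.id_le _)⟩
  set J : ι → ℕ := fun i => Nat.find (hex i) with hJ
  have hJeq : ∀ i j, M j < a i → a i ≤ M (j + 1) → J i = j := by
    intro i j h1 h2
    rw [hJ]
    simp only
    rw [Nat.find_eq_iff]
    refine ⟨h2, fun n hn h3 => ?_⟩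
    have : M (n + 1) ≤ M j := hmono.monotone hn
    omega
  obtain ⟨n₀, hn₀⟩ := eventually_atTop.1 (hR fun i => col (M (J i)) i)
  refine hmiss (M n₀) (fun i => col (M (J i)) i) ?_ (hn₀ _ ?_)
  · intro i h1 h2
    rw [← hMs] at h2
    rw [hJeq i n₀ h1 h2]
  · exact (hmono.id_le _).trans (hz _).le

/-! ### Upper bound: subset sums and shift defects -/

/-- The set of all sums of `f` over subsets of `T`. -/
def sumsOf (f : ℕ → ℤ) (T : Finset ℕ) : Finset ℤ := T.powerset.image fun U => ∑ v ∈ U, f v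

lemma mem_sumsOf {f : ℕ → ℤ} {T : Finset ℕ} {z : ℤ} :
    z ∈ sumsOf f T ↔ ∃ U ⊆ T, ∑ v ∈ U, f v = z := by
  simp [sumsOf]

lemma zero_mem_sumsOf (f : ℕ → ℤ) (T : Finset ℕ) : 0 ∈ sumsOf f T :=
  mem_sumsOf.2 ⟨∅, by simp, by simp⟩

lemma sumsOf_mono {f : ℕ → ℤ} {T T' : Finset ℕ} (h : T ⊆ T') : sumsOf f T ⊆ sumsOf f T' :=
  Finset.image_subset_image (Finset.powerset_mono.2 h)

lemma add_mem_sumsOf {f : ℕ → ℤ} {T T' : Finset ℕ} (h : Disjoint T T') {y z : ℤ}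
    (hy : y ∈ sumsOf f T) (hz : z ∈ sumsOf f T') : y + z ∈ sumsOf f (T ∪ T') := by
  obtain ⟨U, hU, rfl⟩ := mem_sumsOf.1 hy
  obtain ⟨U', hU', rfl⟩ := mem_sumsOf.1 hz
  exact mem_sumsOf.2 ⟨U ∪ U', Finset.union_subset_union hU hU',
    Finset.sum_union (Finset.disjoint_of_subset_left hU (Finset.disjoint_of_subset_right hU' h))⟩

lemma sumsOf_le {f : ℕ → ℤ} {T : Finset ℕ} {M : ℤ} (h : ∀ v ∈ T, 0 ≤ f v ∧ f v ≤ M) {z : ℤ}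
    (hz : z ∈ sumsOf f T) : 0 ≤ z ∧ z ≤ T.card * M := by
  obtain ⟨U, hU, rfl⟩ := mem_sumsOf.1 hz
  refine ⟨Finset.sum_nonneg fun v hv => (h v (hU hv)).1, ?_⟩
  calc ∑ v ∈ U, f v ≤ ∑ v ∈ T, f v :=
        Finset.sum_le_sum_of_subset_of_nonneg hU fun v hv _ => (h v hv).1
    _ ≤ ∑ _v ∈ T, M := Finset.sum_le_sum fun v hv => (h v hv).2
    _ = T.card * M := by simp

lemma card_sumsOf_le {f : ℕ → ℤ} {T : Finset ℕ} {M : ℕ} (h : ∀ v ∈ T, 0 ≤ f v ∧ f v ≤ M) :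
    (sumsOf f T).card ≤ T.card * M + 1 := by
  have : sumsOf f T ⊆ Finset.Icc (0 : ℤ) ((T.card * M : ℕ) : ℤ) := by
    intro z hz
    rw [Finset.mem_Icc]
    exact_mod_cast sumsOf_le h hz
  refine (Finset.card_le_card this).trans ?_
  simp

/-- The number of elements of `X` which leave `X` under the shift by `g`. -/
def shiftDefect (X : Finset ℤ) (g : ℤ) : ℕ := ({x ∈ X | x + g ∉ X} : Finset ℤ).card

lemma shiftDefect_zero (X : Finset ℤ) : shiftDefect X 0 = 0 := by
  simp [shiftDefect]

/-- An element that leaves under g + h either leaves under g, or arrives at an element of X that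
leaves under h. -/
lemma shiftDefect_add_le (X : Finset ℤ) (g h : ℤ) :
    shiftDefect X (g + h) ≤ shiftDefect X g + shiftDefect X h := by
  unfold shiftDefect
  have hsub : ({x ∈ X | x + (g + h) ∉ X} : Finset ℤ) ⊆
      ({x ∈ X | x + g ∉ X} : Finset ℤ) ∪ ({x ∈ X | x + h ∉ X} : Finset ℤ).image (· - g) := by
    intro x hx
    rw [Finset.mem_filter] at hx
    rw [Finset.mem_union, Finset.mem_filter, Finset.mem_image]
    by_cases h1 : x + g ∈ X
    · right
      refine ⟨x + g, ?_, by simp⟩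
      rw [Finset.mem_filter]
      exact ⟨h1, by rw [add_assoc]; exact hx.2⟩
    · exact Or.inl ⟨hx.1, h1⟩
  exact (Finset.card_le_card hsub).trans
    ((Finset.card_union_le _ _).trans (Nat.add_le_add_left Finset.card_image_le _))

lemma card_shift_mem_add_shiftDefect (X : Finset ℤ) (g : ℤ) :
    ({x ∈ X | x + g ∈ X} : Finset ℤ).card + shiftDefect X g = X.card :=
  Finset.card_filter_add_card_filter_not _

lemma shiftDefect_neg (X : Finset ℤ) (g : ℤ) : shiftDefect X (-g) = shiftDefect X g := by
  have h1 := card_shift_mem_add_shiftDefect X g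
  have h2 := card_shift_mem_add_shiftDefect X (-g)
  have h3 : ({x ∈ X | x + g ∈ X} : Finset ℤ).card = ({x ∈ X | x + -g ∈ X} : Finset ℤ).card :=
    Finset.card_bij' (fun x _ => x + g) (fun x _ => x + -g)
      (fun x hx => by
        rw [Finset.mem_filter] at hx ⊢
        exact ⟨hx.2, by rw [add_neg_cancel_right]; exact hx.1⟩)
      (fun x hx => by
        rw [Finset.mem_filter] at hx ⊢
        exact ⟨hx.2, by rw [neg_add_cancel_right]; exact hx.1⟩)
      (fun x _ => by simp) (fun x _ => by simp)
  omega

lemma shiftDefect_nat_mul_le (X : Finset ℤ) (n : ℕ) (g : ℤ) :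
    shiftDefect X (n * g) ≤ n * shiftDefect X g := by
  induction n with
  | zero => simp [shiftDefect_zero]
  | succ n ih =>
    have := shiftDefect_add_le X (n * g) g
    push_cast
    rw [add_mul, one_mul, add_mul, one_mul]
    omega

/-- The translates by f v that leave the old set of sums are new sums. -/
lemma card_sumsOf_insert {f : ℕ → ℤ} {T : Finset ℕ} {v : ℕ} (hv : v ∉ T) :
    (sumsOf f T).card + shiftDefect (sumsOf f T) (f v) ≤ (sumsOf f (insert v T)).card := by
  set X := sumsOf f T
  have hsub : X ∪ ({x ∈ X | x + f v ∉ X} : Finset ℤ).image (· + f v) ⊆ sumsOf f (insert v T) := by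
    apply Finset.union_subset (sumsOf_mono (Finset.subset_insert _ _))
    intro z hz
    obtain ⟨x, hx, rfl⟩ := Finset.mem_image.1 hz
    rw [Finset.mem_filter] at hx
    have h2 : f v ∈ sumsOf f {v} := mem_sumsOf.2 ⟨{v}, by simp, by simp⟩
    have h3 := add_mem_sumsOf (by simpa using hv) hx.1 h2
    rwa [Finset.union_comm, ← Finset.insert_eq] at h3
  refine le_trans (le_of_eq ?_) (Finset.card_le_card hsub)
  rw [Finset.card_union_of_disjoint, Finset.card_image_of_injective _ (add_left_injective _)]
  · rfl
  · rw [Finset.disjoint_right]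
    intro z hz
    obtain ⟨x, hx, rfl⟩ := Finset.mem_image.1 hz
    exact (Finset.mem_filter.1 hx).2

/-- Few shifts keep half of a finite set of integers inside itself. -/
lemma card_small_shiftDefect_le {f : ℕ → ℤ} (hf : Function.Injective f) (Ω : Finset ℕ)
    {X : Finset ℤ} (hX : X.Nonempty) :
    ({v ∈ Ω | 2 * shiftDefect X (f v) ≤ X.card} : Finset ℕ).card ≤ 2 * X.card := by
  set S := ({v ∈ Ω | 2 * shiftDefect X (f v) ≤ X.card} : Finset ℕ)
  -- Double counting of pairs in X × X: each v in S keeps at least half of X inside X, and for fixed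
  -- x distinct v give distinct x + f v.
  have h1 : S.card * X.card ≤ 2 * ∑ v ∈ S, ({x ∈ X | x + f v ∈ X} : Finset ℤ).card := by
    rw [Finset.mul_sum, ← smul_eq_mul, ← Finset.sum_const]
    apply Finset.sum_le_sum
    intro v hv
    have h2 := (Finset.mem_filter.1 hv).2
    have h3 := card_shift_mem_add_shiftDefect X (f v)
    omega
  have h2 : ∑ v ∈ S, ({x ∈ X | x + f v ∈ X} : Finset ℤ).card ≤ X.card * X.card := by
    simp_rw [Finset.card_filter]
    rw [Finset.sum_comm]
    calc ∑ x ∈ X, ∑ v ∈ S, (if x + f v ∈ X then 1 else 0) ≤ ∑ _x ∈ X, X.card := by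
          apply Finset.sum_le_sum
          intro x _
          rw [← Finset.card_filter]
          apply Finset.card_le_card_of_injOn (fun v => x + f v)
          · intro v hv
            exact (Finset.mem_filter.1 hv).2
          · intro v _ v' _ h
            exact hf (add_left_cancel h)
      _ = X.card * X.card := by simp
  have h3 : 0 < X.card := hX.card_pos
  nlinarith

/-- If a dense set of `v` gives small shift defects for `1 + Q v`, then every `g` has a bounded
multiple `c g` such that the shift by `Q c g` has a small defect. -/
lemma exists_mul_shiftDefect_le {X : Finset ℤ} {Q m w E : ℕ} {S : Finset ℕ}
    (hS : S ⊆ Finset.Ico m (2 * m)) (hcard : m < w * S.card)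
    (hE : ∀ v ∈ S, E * shiftDefect X (1 + Q * v) ≤ X.card) {g : ℕ} (hg : 2 * w * g ≤ m) :
    ∃ c, 1 ≤ c ∧ c ≤ 2 * w ∧ E * shiftDefect X (Q * (c * g)) ≤ 2 * X.card := by
  have main : ∀ i i' s s' : ℕ, s ∈ S → s' ∈ S → i < i' → i' ≤ 2 * w → s + i * g = s' + i' * g →
      ∃ c, 1 ≤ c ∧ c ≤ 2 * w ∧ E * shiftDefect X (Q * (c * g)) ≤ 2 * X.card := by
    intro i i' s s' hs hs' hi hi' h
    refine ⟨i' - i, by omega, by omega, ?_⟩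
    have e : (Q : ℤ) * (((i' - i : ℕ) : ℤ) * g) = (1 + Q * s) + -(1 + Q * s') := by
      have h' : (s : ℤ) + i * g = s' + i' * g := by exact_mod_cast h
      rw [Nat.cast_sub hi.le]
      linear_combination (Q : ℤ) * (-h')
    have h1 := shiftDefect_add_le X (1 + Q * s) (-(1 + Q * s'))
    rw [shiftDefect_neg] at h1
    rw [e]
    have h2 := hE s hs
    have h3 := hE s' hs'
    calc E * shiftDefect X ((1 + Q * s) + -(1 + Q * s'))
        ≤ E * (shiftDefect X (1 + Q * s) + shiftDefect X (1 + Q * s')) :=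
          Nat.mul_le_mul_left _ h1
      _ ≤ 2 * X.card := by rw [mul_add]; omega
  -- The 2w + 1 translates S + ig lie in [m, 3m) and have total size above 2m, so two of them meet.
  obtain ⟨p, hp, p', hp', hne, heq⟩ :=
    Finset.exists_ne_map_eq_of_card_lt_of_maps_to (s := Finset.range (2 * w + 1) ×ˢ S)
      (t := Finset.Ico m (3 * m)) (f := fun p => p.2 + p.1 * g)
      (by
        rw [Nat.card_Ico, Finset.card_product, Finset.card_range]
        have : (2 * w + 1) * S.card = 2 * (w * S.card) + S.card := by ring
        omega)
      (by
        intro p hp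
        have hp := Finset.mem_product.1 hp
        have h1 := Finset.mem_range.1 hp.1
        have h2 := Finset.mem_Ico.1 (hS hp.2)
        have h3 : p.1 * g ≤ 2 * w * g := Nat.mul_le_mul_right _ (by omega)
        simp only [Finset.coe_Ico, Set.mem_Ico]
        omega)
  rw [Finset.mem_product, Finset.mem_range] at hp hp'
  rcases lt_trichotomy p.1 p'.1 with h | h | h
  · exact main _ _ _ _ hp.2 hp'.2 h (by omega) heq
  · exfalso
    apply hne
    rw [h] at heq
    exact Prod.ext h (by omega)
  · exact main _ _ _ _ hp'.2 hp.2 h (by omega) heq.symm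

/-- The multiplier c depends on g, but it divides (2w)!, so one further factor (2w)! removes the
dependence. -/
lemma shiftDefect_factorial_le {X : Finset ℤ} {m w E : ℕ} {S : Finset ℕ}
    (hS : S ⊆ Finset.Ico m (2 * m)) (hcard : m < w * S.card)
    (hE : ∀ v ∈ S, E * shiftDefect X (1 + (2 * w).factorial * v) ≤ X.card) {g : ℕ}
    (hg : 2 * w * g ≤ m) :
    E * shiftDefect X (((2 * w).factorial ^ 2 : ℕ) * g) ≤ 2 * (2 * w).factorial * X.card := by
  obtain ⟨c, hc1, hc2, hc⟩ := exists_mul_shiftDefect_le hS hcard hE hg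
  obtain ⟨d, hd⟩ : c ∣ (2 * w).factorial := Nat.dvd_factorial hc1 hc2
  have e : (((2 * w).factorial ^ 2 : ℕ) : ℤ) * g = d * ((2 * w).factorial * (c * g)) := by
    have hd' : (((2 * w).factorial : ℕ) : ℤ) = c * d := by exact_mod_cast hd
    push_cast
    linear_combination ((2 * w).factorial : ℤ) * g * hd'
  rw [e]
  calc _ ≤ E * (d * shiftDefect X ((2 * w).factorial * (c * g))) :=
        Nat.mul_le_mul_left _ (shiftDefect_nat_mul_le _ _ _)
    _ = d * (E * shiftDefect X ((2 * w).factorial * (c * g))) := by ring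
    _ ≤ d * (2 * X.card) := Nat.mul_le_mul_left _ hc
    _ ≤ (2 * w).factorial * (2 * X.card) := by
        apply Nat.mul_le_mul_right
        rw [hd]
        exact Nat.le_mul_of_pos_left _ hc1
    _ = _ := by ring

/-- By subadditivity, a range of shifts t times longer costs a factor t in the defect. -/
lemma shiftDefect_le_of_le_mul {X : Finset ℤ} {E D κ g₁ : ℕ}
    (h : ∀ g ≤ g₁, E * shiftDefect X (D * (g : ℕ)) ≤ κ) (t : ℕ) :
    ∀ g ≤ t * g₁, E * shiftDefect X (D * (g : ℕ)) ≤ t * κ := by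
  induction t with
  | zero =>
    intro g hg
    have : g = 0 := by omega
    subst this
    simp [shiftDefect_zero]
  | succ t ih =>
    intro g hg
    rcases le_total g g₁ with h1 | h1
    · exact (h g h1).trans (Nat.le_mul_of_pos_left _ (by omega))
    · obtain ⟨g', rfl⟩ := Nat.exists_eq_add_of_le h1
      have h2 := ih g' (by rw [add_mul] at hg; omega)
      have h3 := h g₁ le_rfl
      have h4 := shiftDefect_add_le X (D * (g₁ : ℕ)) (D * (g' : ℕ))
      push_cast
      rw [mul_add]
      calc _ ≤ E * (shiftDefect X (D * (g₁ : ℕ)) + shiftDefect X (D * (g' : ℕ))) :=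
            Nat.mul_le_mul_left _ h4
        _ ≤ (t + 1) * κ := by rw [mul_add, add_mul]; omega

/-- A set which is almost invariant under the shifts by `D g`, `g < G`, contains most of an
arithmetic progression of difference `D` and length `G`. -/
lemma exists_dense_progression {X : Finset ℤ} (hX : X.Nonempty) {D G : ℕ}
    (h : ∀ g < G, 4 * shiftDefect X (D * (g : ℕ)) ≤ X.card) :
    ∃ x : ℤ, 4 * ({g ∈ Finset.range G | x + D * (g : ℕ) ∉ X} : Finset ℕ).card ≤ G := by
  have hsum : ∑ x ∈ X, 4 * ({g ∈ Finset.range G | x + D * (g : ℕ) ∉ X} : Finset ℕ).card ≤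
      ∑ _x ∈ X, G := by
    rw [← Finset.mul_sum]
    simp_rw [Finset.card_filter]
    rw [Finset.sum_comm, Finset.mul_sum]
    calc _ ≤ ∑ _g ∈ Finset.range G, X.card := by
          apply Finset.sum_le_sum
          intro g hg
          rw [← Finset.card_filter]
          exact h g (Finset.mem_range.1 hg)
      _ = ∑ _x ∈ X, G := by simp [mul_comm]
  obtain ⟨x, -, hx⟩ := Finset.exists_le_of_sum_le hX hsum
  exact ⟨x, hx⟩

/-- The sum of two sets with dense parts of progressions contains a full progression. -/
lemma exists_progression_of_dense {X Y : Finset ℤ} {D G : ℕ} {x y : ℤ}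
    (hx : 4 * ({g ∈ Finset.range G | x + D * (g : ℕ) ∉ X} : Finset ℕ).card ≤ G)
    (hy : 4 * ({g ∈ Finset.range G | y + D * (g : ℕ) ∉ Y} : Finset ℕ).card ≤ G)
    {e : ℕ} (he : 2 * e < G) :
    ∃ x' ∈ X, ∃ y' ∈ Y, x' + y' = x + y + D * (G - 1 : ℕ) + D * e := by
  set BX := ({g ∈ Finset.range G | x + D * (g : ℕ) ∉ X} : Finset ℕ)
  set BY := ({g ∈ Finset.range G | y + D * (g : ℕ) ∉ Y} : Finset ℕ)
  -- The target splits as index g in X plus index G - 1 + e - g in Y. More than G / 2 values of g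
  -- are admissible, and each side excludes at most G / 4.
  obtain ⟨g, hg, hgB⟩ : ∃ g ∈ Finset.Ico e G, g ∉ BX ∪ BY.image (fun g => G - 1 + e - g) := by
    apply Finset.exists_mem_notMem_of_card_lt_card
    have h1 := Finset.card_union_le BX (BY.image (fun g => G - 1 + e - g))
    have h2 : (BY.image (fun g => G - 1 + e - g)).card ≤ BY.card := Finset.card_image_le
    rw [Nat.card_Ico]
    omega
  rw [Finset.mem_Ico] at hg
  rw [Finset.mem_union, not_or] at hgB
  refine ⟨x + D * g, ?_, y + D * (G - 1 + e - g : ℕ), ?_, ?_⟩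
  · by_contra hc
    exact hgB.1 (Finset.mem_filter.2 ⟨Finset.mem_range.2 hg.2, hc⟩)
  · by_contra hc
    apply hgB.2
    rw [Finset.mem_image]
    exact ⟨G - 1 + e - g, Finset.mem_filter.2 ⟨Finset.mem_range.2 (by omega), hc⟩, by omega⟩
  · rw [Nat.cast_sub (by omega)]
    push_cast
    ring

/-! ### Upper bound: generic sets -/

/-- Since F ignores the coordinates in J, fixing the others fixes F, which leaves at most s choices
for each coordinate in J. -/
lemma card_tuples_mem_le {n m s : ℕ} {Ω : Finset ℕ} (hΩ : Ω.card = m) (J : Finset (Fin n))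
    (F : (Fin n → ℕ) → Finset ℕ) (hF : ∀ a a', (∀ i ∉ J, a i = a' i) → F a = F a')
    (hs : ∀ a, (F a).card ≤ s) :
    ({a ∈ Fintype.piFinset fun _ : Fin n => Ω | ∀ j ∈ J, a j ∈ F a} : Finset (Fin n → ℕ)).card ≤
      s ^ J.card * m ^ (n - J.card) := by
  classical
  set B := ({a ∈ Fintype.piFinset fun _ : Fin n => Ω | ∀ j ∈ J, a j ∈ F a} : Finset (Fin n → ℕ))
  set f : (Fin n → ℕ) → Fin n → ℕ := fun a i => if i ∈ J then 0 else a i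
  have himage : (B.image f).card ≤ m ^ (n - J.card) := by
    have hsub : B.image f ⊆ Fintype.piFinset fun i => if i ∈ J then {0} else Ω := by
      intro b hb
      obtain ⟨a, ha, rfl⟩ := Finset.mem_image.1 hb
      rw [Fintype.mem_piFinset]
      intro i
      by_cases hi : i ∈ J
      · simp [f, hi]
      · simpa [f, hi] using Fintype.mem_piFinset.1 (Finset.mem_filter.1 ha).1 i
    refine (Finset.card_le_card hsub).trans ?_
    rw [Fintype.card_piFinset]
    have : ∀ i, (if i ∈ J then ({0} : Finset ℕ) else Ω).card = if i ∈ J then 1 else m := by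
      intro i
      split_ifs <;> simp [hΩ]
    simp_rw [this]
    rw [Finset.prod_ite]
    simp [Finset.filter_not, Finset.card_sdiff]
  refine (Finset.card_le_mul_card_image (f := f) B (s ^ J.card) ?_).trans
    (Nat.mul_le_mul_left _ himage)
  intro b _
  have hsub : ({a ∈ B | f a = b} : Finset (Fin n → ℕ)) ⊆
      Fintype.piFinset fun i => if i ∈ J then F b else {b i} := by
    intro a ha
    obtain ⟨haB, rfl⟩ := Finset.mem_filter.1 ha
    have hFa : F a = F (f a) := hF _ _ fun i hi => by simp [f, hi]
    rw [Fintype.mem_piFinset]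
    intro i
    by_cases hi : i ∈ J
    · simpa [hi, ← hFa] using (Finset.mem_filter.1 haB).2 i hi
    · simp [f, hi]
  refine (Finset.card_le_card hsub).trans ?_
  rw [Fintype.card_piFinset]
  have : ∀ i, (if i ∈ J then F b else {b i}).card = if i ∈ J then (F b).card else 1 := by
    intro i
    split_ifs <;> simp
  simp_rw [this]
  rw [Finset.prod_ite]
  simpa using Nat.pow_le_pow_left (hs b) J.card

/-- There is a set no large part of which is contained in the small set attached to another,
disjoint part. -/
lemma exists_generic_finset {n k m s : ℕ} {Ω : Finset ℕ} (hΩ : Ω.card = m)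
    (S : Finset ℕ → Finset ℕ) (hS : ∀ T, (S T).card ≤ s)
    (h : 4 ^ n * (s ^ k * m ^ (n - k)) + n * n * m ^ (n - 1) < m ^ n) :
    ∃ A ⊆ Ω, A.card = n ∧ ∀ T ⊆ A, ∀ R ⊆ A, Disjoint T R → k ≤ R.card → ¬ R ⊆ S T := by
  classical
  -- Union bound over random n-tuples: `Bad₁` is a violation for one of at most 4 ^ n pairs of index
  -- sets, `Bad₂` a repeated entry.
  set Bad₁ : Finset (Fin n → ℕ) := ((Finset.univ : Finset (Finset (Fin n) × Finset (Fin n))).filter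
    fun p => Disjoint p.1 p.2 ∧ p.2.card = k).biUnion fun p =>
      {a ∈ Fintype.piFinset fun _ : Fin n => Ω | ∀ j ∈ p.2, a j ∈ S (p.1.image a)} with hBad₁
  set Bad₂ : Finset (Fin n → ℕ) := ((Finset.univ : Finset (Fin n × Fin n)).filter
    fun p => p.1 ≠ p.2).biUnion fun p =>
      {a ∈ Fintype.piFinset fun _ : Fin n => Ω | ∀ j ∈ ({p.2} : Finset (Fin n)),
        a j ∈ ({a p.1} : Finset ℕ)} with hBad₂
  have h1 : Bad₁.card ≤ 4 ^ n * (s ^ k * m ^ (n - k)) := by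
    refine (Finset.card_biUnion_le_card_mul _ _ (s ^ k * m ^ (n - k)) ?_).trans ?_
    · rintro ⟨I, J⟩ hp
      obtain ⟨-, hd, rfl⟩ := Finset.mem_filter.1 hp
      refine card_tuples_mem_le hΩ J (fun a => S (I.image a)) ?_ fun a => hS _
      intro a a' haa
      have : I.image a = I.image a' := Finset.image_congr fun i hi =>
        haa i (Finset.disjoint_left.1 hd hi)
      simp only [this]
    · apply Nat.mul_le_mul_right
      refine (Finset.card_filter_le _ _).trans ?_
      rw [Finset.card_univ, Fintype.card_prod, Fintype.card_finset, Fintype.card_fin, ← mul_pow]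
      norm_num
  have h2 : Bad₂.card ≤ n * n * m ^ (n - 1) := by
    refine (Finset.card_biUnion_le_card_mul _ _ (m ^ (n - 1)) ?_).trans ?_
    · rintro ⟨i, j⟩ hp
      have hij := (Finset.mem_filter.1 hp).2
      have := card_tuples_mem_le (s := 1) hΩ {j} (fun a => {a i}) (fun a a' haa => by
        rw [haa i (by simpa using hij)]) (fun a => by simp)
      simpa using this
    · apply Nat.mul_le_mul_right
      refine (Finset.card_filter_le _ _).trans ?_
      simp
  obtain ⟨a, ha, hab⟩ : ∃ a ∈ Fintype.piFinset fun _ : Fin n => Ω, a ∉ Bad₁ ∪ Bad₂ := by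
    apply Finset.exists_mem_notMem_of_card_lt_card
    rw [Fintype.card_piFinset]
    simp only [hΩ, Finset.prod_const, Finset.card_univ, Fintype.card_fin]
    exact lt_of_le_of_lt (Finset.card_union_le _ _) (by omega)
  rw [Finset.mem_union, not_or] at hab
  have hinj : Function.Injective a := by
    intro i j hij
    by_contra hne
    apply hab.2
    rw [hBad₂, Finset.mem_biUnion]
    refine ⟨(i, j), by simpa using hne, ?_⟩
    rw [Finset.mem_filter]
    exact ⟨ha, by simpa using hij.symm⟩
  refine ⟨Finset.univ.image a, ?_, ?_, ?_⟩
  · intro v hv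
    obtain ⟨i, -, rfl⟩ := Finset.mem_image.1 hv
    exact Fintype.mem_piFinset.1 ha i
  · rw [Finset.card_image_of_injective _ hinj, Finset.card_univ, Fintype.card_fin]
  · intro T hT R hR hTR hk hRS
    obtain ⟨R', hR'R, hR'k⟩ := Finset.exists_subset_card_eq hk
    obtain ⟨I, -, rfl⟩ := Finset.subset_image_iff.1 hT
    obtain ⟨J, -, rfl⟩ := Finset.subset_image_iff.1 (hR'R.trans hR)
    rw [Finset.card_image_of_injective _ hinj] at hR'k
    apply hab.1
    rw [hBad₁, Finset.mem_biUnion]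
    refine ⟨(I, J), ?_, ?_⟩
    · rw [Finset.mem_filter]
      refine ⟨Finset.mem_univ _, ?_, hR'k⟩
      exact (Finset.disjoint_image hinj).1 (Finset.disjoint_of_subset_right hR'R hTR)
    · rw [Finset.mem_filter]
      exact ⟨ha, fun j hj => hRS (hR'R (Finset.mem_image_of_mem a hj))⟩

/-! ### Upper bound: growth of the subset sums and dense progressions -/

/-- Greedy growth of the set of subset sums: either every step multiplies its size by at least
`1 + 1 / E`, or many shifts have small defect. -/
lemma exists_growing_subset {f : ℕ → ℤ} {A Ω : Finset ℕ} {k m w E : ℕ} (hA : A ⊆ Ω)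
    (hgen : ∀ T ⊆ A, ∀ R ⊆ A, Disjoint T R → k ≤ R.card →
      R ⊆ {v ∈ Ω | E * shiftDefect (sumsOf f T) (f v) ≤ (sumsOf f T).card} →
      m < w * ({v ∈ Ω | E * shiftDefect (sumsOf f T) (f v) ≤ (sumsOf f T).card} :
        Finset ℕ).card)
    {B T₀ : Finset ℕ} (hB : B ⊆ A) (hT₀ : T₀ ⊆ B) (i : ℕ) (hi : T₀.card + i + k ≤ B.card) :
    ∃ T ⊆ B, T.card ≤ T₀.card + i ∧
      ((E + 1) ^ i * (sumsOf f T₀).card ≤ E ^ i * (sumsOf f T).card ∨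
        m < w * ({v ∈ Ω | E * shiftDefect (sumsOf f T) (f v) ≤ (sumsOf f T).card} :
          Finset ℕ).card) := by
  induction i with
  | zero => exact ⟨T₀, hT₀, by omega, Or.inl (by simp)⟩
  | succ i ih =>
    obtain ⟨T, hTB, hTc, h | h⟩ := ih (by omega)
    swap
    · exact ⟨T, hTB, by omega, Or.inr h⟩
    -- At least k elements of B are unused. If all have small defect, genericity gives many such
    -- shifts; otherwise one of them makes the set of sums grow.
    by_cases hR : B \ T ⊆ {v ∈ Ω | E * shiftDefect (sumsOf f T) (f v) ≤ (sumsOf f T).card}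
    · refine ⟨T, hTB, by omega, Or.inr (hgen T (hTB.trans hB) (B \ T)
        (Finset.sdiff_subset.trans hB) Finset.disjoint_sdiff ?_ hR)⟩
      rw [Finset.card_sdiff_of_subset hTB]
      omega
    · obtain ⟨v, hv, hvS⟩ := Finset.not_subset.1 hR
      rw [Finset.mem_sdiff] at hv
      have hdef : (sumsOf f T).card < E * shiftDefect (sumsOf f T) (f v) := by
        by_contra hc
        exact hvS (Finset.mem_filter.2 ⟨hA (hB hv.1), not_lt.1 hc⟩)
      refine ⟨insert v T, Finset.insert_subset hv.1 hTB, ?_, Or.inl ?_⟩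
      · rw [Finset.card_insert_of_notMem hv.2]
        omega
      · have h2 := card_sumsOf_insert (f := f) hv.2
        calc (E + 1) ^ (i + 1) * (sumsOf f T₀).card
            = (E + 1) * ((E + 1) ^ i * (sumsOf f T₀).card) := by ring
          _ ≤ (E + 1) * (E ^ i * (sumsOf f T).card) := Nat.mul_le_mul_left _ h
          _ = E ^ i * (E * (sumsOf f T).card + (sumsOf f T).card) := by ring
          _ ≤ E ^ i * (E * (sumsOf f T).card + E * shiftDefect (sumsOf f T) (f v)) := by
              gcongr
          _ = E ^ i * (E * ((sumsOf f T).card + shiftDefect (sumsOf f T) (f v))) := by ring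
          _ ≤ E ^ i * (E * (sumsOf f (insert v T)).card) := by gcongr
          _ = E ^ (i + 1) * (sumsOf f (insert v T)).card := by ring

/-- `A` is generic at scale `k`: a set of `k` elements of `A` consists of shifts with small defect
for the subset sums of a disjoint subset of `A` only if there are many such shifts in total. -/
def IsGeneric (k w E Q : ℕ) (A : Finset ℕ) : Prop :=
  ∀ T ⊆ A, ∀ R ⊆ A, Disjoint T R → k ≤ R.card →
    R ⊆ {v ∈ Finset.Ico (2 ^ k) (2 * 2 ^ k) |
      E * shiftDefect (sumsOf (fun v => 1 + Q * v) T) (1 + Q * v) ≤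
        (sumsOf (fun v => 1 + Q * v) T).card} →
    2 ^ k < w * ({v ∈ Finset.Ico (2 ^ k) (2 * 2 ^ k) |
      E * shiftDefect (sumsOf (fun v => 1 + Q * v) T) (1 + Q * v) ≤
        (sumsOf (fun v => 1 + Q * v) T).card} : Finset ℕ).card

lemma one_add_mul_bounds {Q m v : ℕ} (hQ : 0 < Q) (hv : v ∈ Finset.Ico m (2 * m)) :
    ((Q * m : ℕ) : ℤ) ≤ 1 + Q * v ∧ (1 + Q * v : ℤ) ≤ (2 * Q * m : ℕ) := by
  rw [Finset.mem_Ico] at hv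
  have h1 : Q * m ≤ Q * v := Nat.mul_le_mul_left _ hv.1
  have h2 : Q * (v + 1) ≤ Q * (2 * m) := Nat.mul_le_mul_left _ hv.2
  have h3 : 1 + Q * v ≤ 2 * Q * m := by nlinarith
  constructor
  · exact_mod_cast h1.trans (Nat.le_add_left _ _)
  · exact_mod_cast h3

/-- Growth in two phases: 2k steps with ratio 3/2 bring the number of sums up to about 2 ^ k, up to
a factor depending on w. Then k steps with ratio 1 + 1 / E would exceed the trivial bound, which is
only O(kQ) times 2 ^ k, so the growth must stop. -/
lemma exists_subset_many_small_defects {k w E Q : ℕ} (hw : 0 < w) (hQ : 0 < Q)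
    {A B : Finset ℕ} (hA : A ⊆ Finset.Ico (2 ^ k) (2 * 2 ^ k)) (h2 : IsGeneric k w 2 Q A)
    (hE : IsGeneric k w E Q A) (hk : 2 * w * E ^ k * (6 * k * Q + 1) < (E + 1) ^ k)
    (hBA : B ⊆ A) (hB : 4 * k ≤ B.card) :
    ∃ T ⊆ B, T.card ≤ 3 * k ∧
      2 ^ k < w * ({v ∈ Finset.Ico (2 ^ k) (2 * 2 ^ k) |
        E * shiftDefect (sumsOf (fun v => 1 + Q * v) T) (1 + Q * v) ≤
          (sumsOf (fun v => 1 + Q * v) T).card} : Finset ℕ).card := by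
  set f : ℕ → ℤ := fun v => 1 + Q * v with hf
  have hinj : Function.Injective f := by
    intro v v' h
    have h' : (Q : ℤ) * v = Q * v' := add_left_cancel h
    exact_mod_cast mul_left_cancel₀ (by exact_mod_cast hQ.ne') h'
  obtain ⟨T₀, hT₀B, hT₀c, hT₀⟩ := exists_growing_subset hA h2 hBA (Finset.empty_subset B) (2 * k)
    (by simp; omega)
  rw [Finset.card_empty, zero_add] at hT₀c
  have hT₀X : 2 ^ k ≤ 2 * w * (sumsOf f T₀).card := by
    rcases hT₀ with h | h
    · have h0 : 0 < (sumsOf f ∅).card := Finset.card_pos.2 ⟨0, zero_mem_sumsOf _ _⟩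
      have h1 : 4 ^ k * 2 ^ k ≤ 4 ^ k * (sumsOf f T₀).card := by
        calc 4 ^ k * 2 ^ k = 8 ^ k := by rw [← mul_pow]; norm_num
          _ ≤ 9 ^ k := Nat.pow_le_pow_left (by norm_num) k
          _ = (2 + 1) ^ (2 * k) := by rw [pow_mul]; norm_num
          _ ≤ (2 + 1) ^ (2 * k) * (sumsOf f ∅).card := Nat.le_mul_of_pos_right _ h0
          _ ≤ 2 ^ (2 * k) * (sumsOf f T₀).card := h
          _ = 4 ^ k * (sumsOf f T₀).card := by rw [pow_mul]; norm_num
      exact (Nat.le_of_mul_le_mul_left h1 (by positivity)).trans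
        (Nat.le_mul_of_pos_left _ (by omega))
    -- If the first phase stops early, many shifts keep half of the set of sums inside itself, which
    -- already forces that set to be large.
    · refine h.le.trans ?_
      have := card_small_shiftDefect_le hinj (Finset.Ico (2 ^ k) (2 * 2 ^ k))
        (X := sumsOf f T₀) ⟨0, zero_mem_sumsOf _ _⟩
      calc _ ≤ w * (2 * (sumsOf f T₀).card) := Nat.mul_le_mul_left _ this
        _ = _ := by ring
  obtain ⟨T, hTB, hTc, hT | hT⟩ := exists_growing_subset hA hE hBA hT₀B k (by omega)
  swap
  · exact ⟨T, hTB, by omega, hT⟩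
  exfalso
  have hTX : (sumsOf f T).card ≤ 3 * k * (2 * Q * 2 ^ k) + 1 := by
    refine (card_sumsOf_le (M := 2 * Q * 2 ^ k) fun v hv => ?_).trans ?_
    · have := one_add_mul_bounds hQ (hA (hBA (hTB hv)))
      exact ⟨(Int.natCast_nonneg _).trans this.1, this.2⟩
    · gcongr
      omega
  have hpow : 1 ≤ 2 ^ k := Nat.one_le_two_pow
  have : (E + 1) ^ k * 2 ^ k ≤ 2 * w * E ^ k * (6 * k * Q + 1) * 2 ^ k := by
    calc (E + 1) ^ k * 2 ^ k ≤ (E + 1) ^ k * (2 * w * (sumsOf f T₀).card) := by gcongr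
      _ = 2 * w * ((E + 1) ^ k * (sumsOf f T₀).card) := by ring
      _ ≤ 2 * w * (E ^ k * (sumsOf f T).card) := by gcongr
      _ ≤ 2 * w * (E ^ k * (3 * k * (2 * Q * 2 ^ k) + 2 ^ k)) := by
          gcongr
          omega
      _ = _ := by ring
  have := Nat.le_of_mul_le_mul_right this (by positivity)
  omega

/-- The subset sums of any large part of a generic set contain most of a long progression. -/
lemma exists_dense_progression_of_isGeneric {k w Q : ℕ} (hw : 0 < w)
    (hQ : Q = (2 * w).factorial) (hwk : 2 * w ∣ 2 ^ k)
    {A B : Finset ℕ} (hA : A ⊆ Finset.Ico (2 ^ k) (2 * 2 ^ k)) (h2 : IsGeneric k w 2 Q A)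
    (hE : IsGeneric k w (8 * Q * (16 * Q * w)) Q A)
    (hk : 2 * w * (8 * Q * (16 * Q * w)) ^ k * (6 * k * Q + 1) <
      (8 * Q * (16 * Q * w) + 1) ^ k)
    (hBA : B ⊆ A) (hB : 4 * k ≤ B.card) :
    ∃ T ⊆ B, T.card ≤ 3 * k ∧ ∃ x : ℤ,
      4 * ({g ∈ Finset.range (8 * Q * 2 ^ k) |
        x + (Q ^ 2 : ℕ) * (g : ℕ) ∉ sumsOf (fun v => 1 + Q * v) T} : Finset ℕ).card ≤
        8 * Q * 2 ^ k := by
  have hQ0 : 0 < Q := hQ ▸ Nat.factorial_pos _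
  obtain ⟨T, hTB, hTc, hT⟩ := exists_subset_many_small_defects hw hQ0 hA h2 hE hk hBA hB
  refine ⟨T, hTB, hTc, exists_dense_progression ⟨0, zero_mem_sumsOf _ _⟩ fun g hg => ?_⟩
  obtain ⟨g₁, hg₁⟩ := hwk
  set X := sumsOf (fun v => 1 + (Q : ℤ) * v) T
  -- With 2 ^ k = 2w g₁, reaching 8Q2^k takes t = 16Qw multiples of g₁ at cost 2Q|X| each; E = 8Qt
  -- turns the total into |X| / 4.
  have h := shiftDefect_le_of_le_mul (X := X) (E := 8 * Q * (16 * Q * w)) (D := Q ^ 2)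
    (κ := 2 * Q * X.card) (g₁ := g₁) (fun g hg => by
      subst hQ
      exact shiftDefect_factorial_le (Finset.filter_subset _ _) hT
        (fun v hv => (Finset.mem_filter.1 hv).2) (by rw [hg₁]; gcongr)) (16 * Q * w) g
    (by
      calc g ≤ 8 * Q * 2 ^ k := hg.le
        _ = 16 * Q * w * g₁ := by rw [hg₁]; ring)
  have h' : (2 * Q * (16 * Q * w)) * (4 * shiftDefect X ((Q ^ 2 : ℕ) * (g : ℕ))) ≤
      (2 * Q * (16 * Q * w)) * X.card := by
    calc _ = 8 * Q * (16 * Q * w) * shiftDefect X ((Q ^ 2 : ℕ) * (g : ℕ)) := by ring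
      _ ≤ 16 * Q * w * (2 * Q * X.card) := h
      _ = _ := by ring
  exact Nat.le_of_mul_le_mul_left h' (by positivity)

/-! ### Upper bound: from progressions to intervals -/

/-- An interval of subset sums is extended by further terms not longer than the interval. -/
lemma interval_subset_sumsOf_union {f : ℕ → ℤ} {T : Finset ℕ} {u L : ℤ}
    (h : ∀ z, u ≤ z → z < u + L → z ∈ sumsOf f T) (R : Finset ℕ) (hTR : Disjoint T R)
    (hR : ∀ v ∈ R, 0 ≤ f v ∧ f v ≤ L) :
    ∀ z, u ≤ z → z < u + L + ∑ v ∈ R, f v → z ∈ sumsOf f (T ∪ R) := by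
  induction R using Finset.induction_on with
  | empty => simpa using h
  | insert v R hv ih =>
    intro z hz1 hz2
    rw [Finset.sum_insert hv] at hz2
    rw [Finset.disjoint_insert_right] at hTR
    have ih' := ih hTR.2 fun v' hv' => hR v' (Finset.mem_insert_of_mem hv')
    have hR0 : 0 ≤ ∑ v ∈ R, f v :=
      Finset.sum_nonneg fun v' hv' => (hR v' (Finset.mem_insert_of_mem hv')).1
    have hvL := hR v (Finset.mem_insert_self _ _)
    rw [Finset.union_insert]
    rcases lt_or_ge z (u + L + ∑ v ∈ R, f v) with h1 | h1
    · exact sumsOf_mono (Finset.subset_insert _ _) (ih' z hz1 h1)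
    · have h2 := ih' (z - f v) (by linarith) (by linarith)
      have h3 : f v ∈ sumsOf f {v} := mem_sumsOf.2 ⟨{v}, by simp, by simp⟩
      have h4 := add_mem_sumsOf (by simp [hv, hTR.1]) h2 h3
      rwa [sub_add_cancel, Finset.union_comm, ← Finset.insert_eq] at h4

/-- Sums of `D` congruent terms coprime to `D` represent every residue class modulo `D`. -/
lemma exists_sum_modEq {f : ℕ → ℤ} {D : ℕ} (hD : 0 < D) {F : Finset ℕ} (hF : D ≤ F.card) {u : ℤ}
    (hu : IsCoprime u D) (hFu : ∀ v ∈ F, f v ≡ u [ZMOD D]) (z : ℤ) :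
    ∃ U ⊆ F, U.card ≤ D ∧ ∑ v ∈ U, f v ≡ z [ZMOD D] := by
  obtain ⟨p, q, hpq⟩ := hu
  have hD' : (0 : ℤ) < D := by exact_mod_cast hD
  have hj0 := Int.emod_nonneg (z * p) hD'.ne'
  have hj1 := Int.emod_lt_of_pos (z * p) hD'
  obtain ⟨j, hj⟩ := Int.eq_ofNat_of_zero_le hj0
  have hjD : j < D := by
    rw [hj] at hj1
    exact_mod_cast hj1
  obtain ⟨U, hUF, hUc⟩ := Finset.exists_subset_card_eq (hjD.le.trans hF)
  refine ⟨U, hUF, by omega, ?_⟩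
  have h1 : ∑ v ∈ U, f v ≡ ∑ _v ∈ U, u [ZMOD D] := by
    rw [← ZMod.intCast_eq_intCast_iff]
    push_cast
    exact Finset.sum_congr rfl fun v hv =>
      (ZMod.intCast_eq_intCast_iff _ _ _).2 (hFu v (hUF hv))
  refine h1.trans ?_
  rw [Finset.sum_const, hUc, nsmul_eq_mul]
  have h2 : (j : ℤ) ≡ z * p [ZMOD D] := by
    have : (j : ℤ) = z * p % D := hj.symm
    rw [this]
    exact Int.mod_modEq _ _
  refine (h2.mul_right u).trans ?_
  refine (Int.modEq_iff_dvd.2 ⟨z * q, ?_⟩)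
  linear_combination (-z) * hpq

/-- The subset sums of a large part of a generic set contain a long interval whose position does
not depend on the part. -/
lemma interval_subset_sumsOf_of_isGeneric {k w Q : ℕ} (hw : 0 < w)
    (hQ : Q = (2 * w).factorial) (hwk : 2 * w ∣ 2 ^ k)
    {A B : Finset ℕ} (hA : A ⊆ Finset.Ico (2 ^ k) (2 * 2 ^ k)) (h2 : IsGeneric k w 2 Q A)
    (hE : IsGeneric k w (8 * Q * (16 * Q * w)) Q A)
    (hk : 2 * w * (8 * Q * (16 * Q * w)) ^ k * (6 * k * Q + 1) <
      (8 * Q * (16 * Q * w) + 1) ^ k)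
    (hkQ : Q ^ 2 * Q ^ 2 ≤ k)
    (hBA : B ⊆ A) (hB : 40 * k ≤ B.card) {z : ℤ} (hz1 : 14 * k * Q * 2 ^ k ≤ z)
    (hz2 : z ≤ 29 * k * Q * 2 ^ k) : z ∈ sumsOf (fun v => 1 + Q * v) B := by
  set f : ℕ → ℤ := fun v => 1 + Q * v with hf
  have hQ0 : 0 < Q := hQ ▸ Nat.factorial_pos _
  set D := Q ^ 2 with hD
  have hD0 : 0 < D := by positivity
  have hDk : D ≤ k := (Nat.le_mul_of_pos_left _ hD0).trans hkQ
  have hbd : ∀ v ∈ B, ((Q * 2 ^ k : ℕ) : ℤ) ≤ f v ∧ f v ≤ (2 * Q * 2 ^ k : ℕ) :=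
    fun v hv => one_add_mul_bounds hQ0 (hA (hBA hv))
  have hbd0 : ∀ v ∈ B, 0 ≤ f v ∧ f v ≤ (2 * Q * 2 ^ k : ℕ) := fun v hv =>
    ⟨(Int.natCast_nonneg _).trans (hbd v hv).1, (hbd v hv).2⟩
  obtain ⟨T₁, hT₁B, hT₁c, x₁, hx₁⟩ :=
    exists_dense_progression_of_isGeneric hw hQ hwk hA h2 hE hk hBA (by omega)
  obtain ⟨T₂, hT₂B, hT₂c, x₂, hx₂⟩ :=
    exists_dense_progression_of_isGeneric hw hQ hwk hA h2 hE hk (B := B \ T₁)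
      (Finset.sdiff_subset.trans hBA) (by rw [Finset.card_sdiff_of_subset hT₁B]; omega)
  have hT₂B' := hT₂B.trans Finset.sdiff_subset
  have hT₁₂ : Disjoint T₁ T₂ := Finset.disjoint_of_subset_right hT₂B Finset.disjoint_sdiff
  have hT₁₂B : T₁ ∪ T₂ ⊆ B := Finset.union_subset hT₁B hT₂B'
  have hT₁₂c : (T₁ ∪ T₂).card ≤ 6 * k := (Finset.card_union_le _ _).trans (by omega)
  set y : ℤ := x₁ + x₂ + D * (8 * Q * 2 ^ k - 1 : ℕ) with hy
  have hprog : ∀ e : ℕ, 2 * e < 8 * Q * 2 ^ k → y + D * e ∈ sumsOf f (T₁ ∪ T₂) := by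
    intro e he
    obtain ⟨x', hx', y', hy', h⟩ := exists_progression_of_dense hx₁ hx₂ he
    rw [hy, ← h]
    exact add_mem_sumsOf hT₁₂ hx' hy'
  have hQk : 0 < Q * 2 ^ k := by positivity
  have hybd : 0 ≤ y ∧ y ≤ (6 * k : ℕ) * (2 * Q * 2 ^ k : ℕ) := by
    have h0 := hprog 0 (by positivity)
    rw [Nat.cast_zero, mul_zero, add_zero] at h0
    have h1 := sumsOf_le (fun v hv => hbd0 v (hT₁₂B hv)) h0
    refine ⟨h1.1, h1.2.trans ?_⟩
    gcongr
  -- congruent extra terms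
  obtain ⟨F, hFB, hFc, u, hu, hFu⟩ : ∃ F ⊆ B \ (T₁ ∪ T₂), F.card = D ∧ ∃ u : ℤ,
      IsCoprime u D ∧ ∀ v ∈ F, f v ≡ u [ZMOD D] := by
    obtain ⟨ρ, -, hρ⟩ := Finset.exists_le_card_fiber_of_mul_le_card_of_maps_to
      (s := B \ (T₁ ∪ T₂)) (t := Finset.range D) (f := fun v => v % D) (n := D)
      (fun v _ => Finset.mem_range.2 (Nat.mod_lt _ hD0)) ⟨0, Finset.mem_range.2 hD0⟩ (by
        rw [Finset.card_range, Finset.card_sdiff_of_subset hT₁₂B]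
        omega)
    obtain ⟨F, hF, hFc⟩ := Finset.exists_subset_card_eq hρ
    refine ⟨F, hF.trans (Finset.filter_subset _ _), hFc, f ρ, ?_, ?_⟩
    · rw [hD, Nat.cast_pow]
      apply IsCoprime.pow_right
      exact ⟨1, -ρ, by simp only [hf]; ring⟩
    · intro v hv
      have h1 : v % D = ρ := (Finset.mem_filter.1 (hF hv)).2
      have h2 : (v : ℤ) ≡ ρ [ZMOD D] := by
        rw [← h1]
        push_cast
        exact (Int.mod_modEq _ _).symm
      exact (h2.mul_left _).add_left _
  have hFB' : F ⊆ B := hFB.trans Finset.sdiff_subset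
  have hFdisj : Disjoint (T₁ ∪ T₂) F := Finset.disjoint_of_subset_right hFB Finset.disjoint_sdiff
  -- A sum over F corrects the residue of z - y, and the rest is a multiple De with e < 4Q2^k,
  -- within half the length 8Q2^k. The seed has length at least the largest term, as the extension
  -- needs.
  have hseed : ∀ z : ℤ, y + D * (2 * Q * 2 ^ k : ℕ) ≤ z →
      z < y + D * (2 * Q * 2 ^ k : ℕ) + D * (2 * Q * 2 ^ k : ℕ) →
      z ∈ sumsOf f (T₁ ∪ T₂ ∪ F) := by
    intro z hz1 hz2
    obtain ⟨U, hUF, hUc, hUz⟩ := exists_sum_modEq hD0 hFc.ge hu hFu (z - y)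
    have hUbd := sumsOf_le (fun v hv => hbd0 v (hFB' (hUF hv)))
      (mem_sumsOf.2 ⟨U, subset_rfl, rfl⟩)
    have hUbd' : ∑ v ∈ U, f v ≤ D * (2 * Q * 2 ^ k : ℕ) := hUbd.2.trans (by gcongr)
    obtain ⟨e, he⟩ := Int.modEq_iff_dvd.1 hUz
    have hD0' : (0 : ℤ) < D := by exact_mod_cast hD0
    have he0 : 0 ≤ e := by
      by_contra hc
      have : (D : ℤ) * e < 0 := mul_neg_of_pos_of_neg hD0' (by omega)
      linarith
    obtain ⟨e, rfl⟩ := Int.eq_ofNat_of_zero_le he0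
    have he1 : (D : ℤ) * e < D * (2 * (2 * Q * 2 ^ k : ℕ)) := by
      rw [← he]
      linarith [hUbd.1]
    have he2 : e < 2 * (2 * Q * 2 ^ k) := by
      have := lt_of_mul_lt_mul_left he1 hD0'.le
      exact_mod_cast this
    have h1 := add_mem_sumsOf hFdisj (hprog e (by rw [mul_assoc] at he2 ⊢; omega))
      (mem_sumsOf.2 ⟨U, hUF, rfl⟩)
    have h3 : y + D * e + ∑ v ∈ U, f v = z := by linarith
    rwa [h3] at h1
  set R := B \ (T₁ ∪ T₂ ∪ F) with hR
  have hUB : T₁ ∪ T₂ ∪ F ⊆ B := Finset.union_subset hT₁₂B hFB'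
  have hRc : 33 * k ≤ R.card := by
    rw [hR, Finset.card_sdiff_of_subset hUB]
    have := Finset.card_union_le (T₁ ∪ T₂) F
    omega
  have hRsum : (33 * k * (Q * 2 ^ k) : ℤ) ≤ ∑ v ∈ R, f v := by
    calc (33 * k * (Q * 2 ^ k) : ℤ) ≤ R.card * (Q * 2 ^ k : ℕ) := by
          push_cast
          gcongr
          exact_mod_cast hRc
      _ = ∑ _v ∈ R, ((Q * 2 ^ k : ℕ) : ℤ) := by simp
      _ ≤ _ := Finset.sum_le_sum fun v hv => (hbd v (Finset.sdiff_subset hv)).1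
  -- The seed starts by 12kQ2^k + 2kQ2^k, and the remaining 33k terms push its end beyond 33kQ2^k.
  have hfin := interval_subset_sumsOf_union hseed R Finset.disjoint_sdiff (fun v hv => by
    have h1 := hbd0 v (Finset.sdiff_subset hv)
    refine ⟨h1.1, h1.2.trans ?_⟩
    exact_mod_cast Nat.le_mul_of_pos_left _ hD0) z
  rw [hR, Finset.union_sdiff_of_subset hUB] at hfin
  have hDM : (D : ℤ) * (2 * Q * 2 ^ k : ℕ) ≤ k * (2 * Q * 2 ^ k : ℕ) := by gcongr
  have hDM0 : (0 : ℤ) ≤ (D : ℤ) * (2 * Q * 2 ^ k : ℕ) := by positivity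
  have hkQk : (0 : ℤ) ≤ (k : ℤ) * Q * 2 ^ k := by positivity
  push_cast at *
  have hk1 : (0 : ℤ) < (k : ℤ) * Q * 2 ^ k := by
    have : 0 < k * Q * 2 ^ k := by
      have : 0 < k := by omega
      positivity
    exact_mod_cast this
  apply hfin <;> nlinarith

/-! ### Upper bound: construction of the blocks and of the sequence -/

lemma exists_isGeneric {r k E Q : ℕ} (hr : 0 < r) (hk : 0 < k) (hrk : 80 * r + 3 ≤ k)
    (hk2 : 4 * (40 * r * k) ^ 2 ≤ 2 ^ k) :
    ∃ A ⊆ Finset.Ico (2 ^ k) (2 * 2 ^ k), A.card = 40 * r * k ∧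
      IsGeneric k (2 ^ (80 * r + 3)) 2 Q A ∧ IsGeneric k (2 ^ (80 * r + 3)) E Q A := by
  classical
  set w := 2 ^ (80 * r + 3) with hw
  obtain ⟨b, rfl⟩ := Nat.exists_eq_add_of_le hrk
  set k := 80 * r + 3 + b with hkdef
  set n := 40 * r * k with hn
  have hw0 : 0 < w := by positivity
  let S₀ : ℕ → Finset ℕ → Finset ℕ := fun e T => {v ∈ Finset.Ico (2 ^ k) (2 * 2 ^ k) |
    e * shiftDefect (sumsOf (fun v => 1 + Q * v) T) (1 + Q * v) ≤
      (sumsOf (fun v => 1 + Q * v) T).card}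
  -- Only sparse sets of shifts have to be avoided; dense ones satisfy the conclusion of genericity,
  -- so they are replaced by ∅.
  let S₁ : ℕ → Finset ℕ → Finset ℕ := fun e T => if w * (S₀ e T).card ≤ 2 ^ k then S₀ e T else ∅
  have hS₁ : ∀ e T, (S₁ e T).card ≤ 2 ^ b := by
    intro e T
    simp only [S₁]
    split_ifs with h
    · have h' : 2 ^ k = w * 2 ^ b := by rw [hkdef, hw, pow_add]
      rw [h'] at h
      exact Nat.le_of_mul_le_mul_left h hw0
    · simp
  have hkn : k ≤ n := Nat.le_mul_of_pos_left _ (by omega)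
  have hcard : (Finset.Ico (2 ^ k) (2 * 2 ^ k)).card = 2 ^ k := by
    rw [Nat.card_Ico]
    omega
  obtain ⟨A, hA, hAc, hgen⟩ := exists_generic_finset (n := n) (k := k) (s := 2 ^ (b + 1)) hcard
    (fun T => S₁ 2 T ∪ S₁ E T) (fun T => (Finset.card_union_le _ _).trans (by
      have h1 := hS₁ 2 T
      have h2 := hS₁ E T
      rw [pow_succ]
      omega)) (by
    have h1 : 4 * (4 ^ n * ((2 ^ (b + 1)) ^ k * (2 ^ k) ^ (n - k))) ≤ (2 ^ k) ^ n := by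
      have e1 : (2 ^ k) ^ n = (2 ^ k) ^ k * (2 ^ k) ^ (n - k) := by
        rw [← pow_add]
        congr 1
        omega
      -- In exponents of 2: 4 ^ n gives 80rk, and the union of two sets of size 2 ^ b gives (b +
      -- 1)k. The 3 in 80r + 3 leaves 2k to spare.
      have e2 : 4 * (4 ^ n * (2 ^ (b + 1)) ^ k) ≤ (2 ^ k) ^ k := by
        have h4 : (4 : ℕ) = 2 ^ 2 := by norm_num
        rw [h4, ← pow_mul, ← pow_mul, ← pow_mul, ← pow_add, ← pow_add]
        apply Nat.pow_le_pow_right (by norm_num)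
        have : k * k = (80 * r + 3 + b) * k := by rw [hkdef]
        rw [this, hn]
        nlinarith
      calc _ = 4 * (4 ^ n * (2 ^ (b + 1)) ^ k) * (2 ^ k) ^ (n - k) := by ring
        _ ≤ _ := by
          rw [e1]
          exact Nat.mul_le_mul_right _ e2
    have h2 : 4 * (n * n * (2 ^ k) ^ (n - 1)) ≤ (2 ^ k) ^ n := by
      have e1 : (2 ^ k) ^ n = 2 ^ k * (2 ^ k) ^ (n - 1) := by
        rw [← pow_succ']
        congr 1
        omega
      calc _ = 4 * n ^ 2 * (2 ^ k) ^ (n - 1) := by ring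
        _ ≤ _ := by
          rw [e1]
          exact Nat.mul_le_mul_right _ hk2
    have h3 : 0 < (2 ^ k) ^ n := by positivity
    omega)
  have main : ∀ e, (∀ T, S₁ e T ⊆ S₁ 2 T ∪ S₁ E T) → IsGeneric k w e Q A := by
    intro e he T hT R hR hTR hRk hRS
    by_contra hc
    rw [not_lt] at hc
    refine hgen T hT R hR hTR hRk (Finset.Subset.trans ?_ (he T))
    simp only [S₁]
    rw [if_pos hc]
    exact hRS
  exact ⟨A, hA, hAc, main 2 fun _ => Finset.subset_union_left,
    main E fun _ => Finset.subset_union_right⟩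

lemma eventually_mul_pow_lt_pow (c : ℝ) (j : ℕ) {q : ℝ} (hq : 1 < q) :
    ∀ᶠ k : ℕ in atTop, c * (k : ℝ) ^ j < q ^ k := by
  have h := (tendsto_pow_const_div_const_pow_of_one_lt j hq).const_mul c
  rw [mul_zero] at h
  filter_upwards [h.eventually_lt_const one_pos] with k hk
  have hq0 : 0 < q ^ k := by positivity
  rw [← mul_div_assoc, div_lt_one hq0] at hk
  exact hk

/-- Blocks for a Ramsey complete sequence: `40 r k` terms of size about `2 ^ k`, any `1 / r` of
which represent a prescribed long interval. -/
lemma exists_blocks {r : ℕ} (hr : 0 < r) :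
    ∃ Q : ℕ, 0 < Q ∧ ∃ k₀ ≥ 28, ∀ k ≥ k₀, ∃ A ⊆ Finset.Ico (2 ^ k) (2 * 2 ^ k), A.card = 40 * r * k ∧
      ∀ B ⊆ A, 40 * k ≤ B.card → ∀ z : ℤ, 14 * k * Q * 2 ^ k ≤ z → z ≤ 29 * k * Q * 2 ^ k →
        z ∈ sumsOf (fun v => 1 + Q * v) B := by
  set w := 2 ^ (80 * r + 3) with hw
  have hw0 : 0 < w := by positivity
  set Q := (2 * w).factorial with hQ
  have hQ0 : 0 < Q := Nat.factorial_pos _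
  set E := 8 * Q * (16 * Q * w) with hE
  have hE0 : 0 < E := by positivity
  have hER : (0 : ℝ) < E := by exact_mod_cast hE0
  have h1 := eventually_mul_pow_lt_pow (2 * w * (6 * Q + 1)) 1
    (q := ((E : ℝ) + 1) / E) (by rw [one_lt_div hER]; linarith)
  have h2 := eventually_mul_pow_lt_pow (4 * (40 * r) ^ 2) 2 (q := 2) (by norm_num)
  obtain ⟨k₀, hk₀⟩ := eventually_atTop.1 (h1.and (h2.and
    ((eventually_ge_atTop (80 * r + 4)).and (eventually_ge_atTop (Q ^ 2 * Q ^ 2)))))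
  refine ⟨Q, hQ0, max k₀ 28, le_max_right _ _, fun k hk => ?_⟩
  obtain ⟨hk1, hk2, hk3, hk4⟩ := hk₀ k ((le_max_left _ _).trans hk)
  have hk5 : 0 < k := by omega
  have hk2' : 4 * (40 * r * k) ^ 2 ≤ 2 ^ k := by
    have : ((4 * (40 * r * k) ^ 2 : ℕ) : ℝ) ≤ ((2 ^ k : ℕ) : ℝ) := by
      push_cast
      refine le_trans (le_of_eq ?_) hk2.le
      ring
    exact_mod_cast this
  have hk1' : 2 * w * E ^ k * (6 * k * Q + 1) < (E + 1) ^ k := by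
    rw [div_pow, lt_div_iff₀ (by positivity), pow_one] at hk1
    have h : 2 * w * (6 * Q + 1) * k * E ^ k < (E + 1) ^ k := by exact_mod_cast hk1
    refine lt_of_le_of_lt ?_ h
    calc 2 * w * E ^ k * (6 * k * Q + 1) ≤ 2 * w * E ^ k * (6 * k * Q + k) := by gcongr; omega
      _ = _ := by ring
  obtain ⟨A, hA, hAc, hA2, hAE⟩ := exists_isGeneric (E := E) (Q := Q) hr hk5 (by omega) hk2'
  refine ⟨A, hA, hAc, fun B hB hBc z hz1 hz2 => ?_⟩
  refine interval_subset_sumsOf_of_isGeneric hw0 hQ ?_ hA hA2 hAE hk1' hk4 hB hBc hz1 hz2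
  rw [hw, ← pow_succ']
  exact pow_dvd_pow 2 (by omega)

lemma exists_mem_consecutive {X : ℕ → ℕ} {k₀ z : ℕ} (hX : ∀ k, k ≤ X k) (hz : X k₀ ≤ z) :
    ∃ k ≥ k₀, X k ≤ z ∧ z < X (k + 1) := by
  have hex : ∃ j, z < X (k₀ + j + 1) := ⟨z, by have := hX (k₀ + z + 1); omega⟩
  refine ⟨k₀ + Nat.find hex, Nat.le_add_right _ _, ?_, Nat.find_spec hex⟩
  rcases Nat.eq_zero_or_pos (Nat.find hex) with h | h
  · rw [h]
    exact hz
  · have := Nat.find_min hex (Nat.sub_lt h one_pos)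
    have e : k₀ + (Nat.find hex - 1) + 1 = k₀ + Nat.find hex := by omega
    rw [e] at this
    exact not_lt.1 this

theorem exists_ramseyComplete {r : ℕ} (hr : 2 ≤ r) :
    ∃ a : ℕ → ℕ, StrictMono a ∧ (∀ i, 0 < a i) ∧ IsRamseyComplete r a ∧
      ∀ n : ℕ, 1 ≤ n → CountLE a n (40 / Real.log 2 ^ 2 * r * Real.log n ^ 2) := by
  classical
  obtain ⟨Q, hQ, k₀, hk₀, hblock⟩ := exists_blocks (by omega : 0 < r)
  choose! A hA hAc hAz using hblock
  set P : ℕ → Prop := fun b => ∃ k ≥ k₀, ∃ v ∈ A k, b = 1 + Q * v with hP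
  have hlarge : ∀ k v, k ≥ k₀ → v ∈ A k → 2 ^ k ≤ 1 + Q * v := by
    intro k v hk hv
    have h1 := (Finset.mem_Ico.1 (hA k hk hv)).1
    have h2 : v ≤ Q * v := Nat.le_mul_of_pos_left _ hQ
    omega
  have hinf : {b | P b}.Infinite := by
    rw [Set.infinite_iff_exists_gt]
    intro N
    have hk : k₀ ≤ k₀ + N := Nat.le_add_right _ _
    have hne : (A (k₀ + N)).Nonempty := by
      rw [← Finset.card_pos, hAc _ hk]
      have : 0 < k₀ + N := by omega
      positivity
    obtain ⟨v, hv⟩ := hne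
    refine ⟨1 + Q * v, ⟨_, hk, v, hv, rfl⟩, ?_⟩
    have h1 := hlarge _ v hk hv
    have h2 : k₀ + N < 2 ^ (k₀ + N) := Nat.lt_two_pow_self
    omega
  have hnth : ∀ b, P b → Nat.nth P (Nat.count P b) = b := fun b hb => Nat.nth_count hb
  have hmono : StrictMono (Nat.nth P) := Nat.nth_strictMono hinf
  have hmem : ∀ i, P (Nat.nth P i) := Nat.nth_mem_of_infinite hinf
  refine ⟨Nat.nth P, hmono, ?_, ?_, ?_⟩
  · intro i
    obtain ⟨k, -, v, -, h⟩ := hmem i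
    omega
  · intro χ
    rw [eventually_atTop]
    refine ⟨14 * k₀ * Q * 2 ^ k₀, fun z hz => ?_⟩
    obtain ⟨k, hk, hz1, hz2⟩ := exists_mem_consecutive (X := fun k => 14 * k * Q * 2 ^ k)
      (fun k => by
        calc k = 1 * k * 1 * 1 := by ring
          _ ≤ 14 * k * Q * 2 ^ k := by
            gcongr
            · norm_num
            · exact hQ
            · exact Nat.one_le_two_pow) hz
    -- Consecutive intervals overlap because 28(k + 1) ≤ 29k for k ≥ 28.
    have hz3 : z ≤ 29 * k * Q * 2 ^ k := by
      refine hz2.le.trans ?_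
      calc 14 * (k + 1) * Q * 2 ^ (k + 1) = (28 * k + 28) * Q * 2 ^ k := by ring
        _ ≤ 29 * k * Q * 2 ^ k := by
          gcongr
          omega
    obtain ⟨c, -, hc⟩ := Finset.exists_le_card_fiber_of_mul_le_card_of_maps_to
      (s := A k) (t := (Finset.univ : Finset (Fin r))) (n := 40 * k)
      (f := fun v => χ (Nat.count P (1 + Q * v))) (fun v _ => Finset.mem_univ _)
      ⟨⟨0, by omega⟩, Finset.mem_univ _⟩ (by
        rw [Finset.card_univ, Fintype.card_fin, hAc k hk]
        exact le_of_eq (by ring))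
    have hzs := hAz k hk _ (Finset.filter_subset _ _) hc z (by exact_mod_cast hz1)
      (by exact_mod_cast hz3)
    obtain ⟨U, hU, hUz⟩ := mem_sumsOf.1 hzs
    have hUP : ∀ v ∈ U, P (1 + Q * v) := fun v hv =>
      ⟨k, hk, v, (Finset.mem_filter.1 (hU hv)).1, rfl⟩
    rw [Set.mem_iUnion]
    refine ⟨c, U.image fun v => Nat.count P (1 + Q * v), ?_, ?_⟩
    · intro i hi
      obtain ⟨v, hv, rfl⟩ := Finset.mem_image.1 (Finset.mem_coe.1 hi)
      exact (Finset.mem_filter.1 (hU hv)).2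
    · rw [Finset.sum_image]
      · rw [Finset.sum_congr rfl fun v hv => hnth _ (hUP v hv)]
        exact_mod_cast hUz
      · intro v hv v' hv' h
        have h' := congrArg (Nat.nth P) h
        simp only [hnth _ (hUP v hv), hnth _ (hUP v' hv')] at h'
        exact Nat.eq_of_mul_eq_mul_left hQ (by omega)
  · intro n hn
    have hfin : {i | Nat.nth P i ∈ Set.Icc 1 n}.Finite :=
      (Set.finite_Iic n).subset fun i hi => (hmono.id_le i).trans hi.2
    refine ⟨hfin, ?_⟩
    set K := Nat.log 2 n with hK
    set F : Finset ℕ := (Finset.Icc k₀ K).biUnion fun k => (A k).image fun v => 1 + Q * v with hF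
    have hsub : Nat.nth P '' {i | Nat.nth P i ∈ Set.Icc 1 n} ⊆ F := by
      rintro _ ⟨i, hi, rfl⟩
      obtain ⟨k, hk, v, hv, h⟩ := hmem i
      have hle : 2 ^ k ≤ n := (hlarge k v hk hv).trans (h ▸ hi.2)
      rw [Finset.mem_coe, hF, Finset.mem_biUnion]
      exact ⟨k, Finset.mem_Icc.2 ⟨hk, Nat.le_log_of_pow_le (by norm_num) hle⟩,
        Finset.mem_image.2 ⟨v, hv, h.symm⟩⟩
    -- Blocks meeting [1, n] have k ≤ log₂ n; there are at most K of them since k₀ ≥ 1, each with at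
    -- most 40rK terms.
    have hFc : F.card ≤ 40 * r * K ^ 2 := by
      calc F.card ≤ (Finset.Icc k₀ K).card * (40 * r * K) := by
            apply Finset.card_biUnion_le_card_mul
            intro k hk
            rw [Finset.mem_Icc] at hk
            refine Finset.card_image_le.trans ?_
            rw [hAc k hk.1]
            exact Nat.mul_le_mul_left _ hk.2
        _ ≤ K * (40 * r * K) := by
            apply Nat.mul_le_mul_right
            rw [Nat.card_Icc]
            omega
        _ = _ := by ring
    have hncard : {i | Nat.nth P i ∈ Set.Icc 1 n}.ncard ≤ 40 * r * K ^ 2 := by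
      rw [← Set.ncard_image_of_injective _ hmono.injective]
      refine (Set.ncard_le_ncard hsub (Finset.finite_toSet _)).trans ?_
      rwa [Set.ncard_coe_finset]
    have hlog2 : 0 < Real.log 2 := Real.log_pos (by norm_num)
    have hKlog : (K : ℝ) ≤ Real.log n / Real.log 2 := Real.natLog_le_logb n 2
    calc (({i | Nat.nth P i ∈ Set.Icc 1 n}.ncard : ℕ) : ℝ) ≤ 40 * r * (K : ℝ) ^ 2 := by
          exact_mod_cast hncard
      _ ≤ 40 * r * (Real.log n / Real.log 2) ^ 2 := by gcongr
      _ = _ := by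
          field_simp

theorem mainTheorem1 :
    (∃ C : ℝ, ∀ r : ℕ, 2 ≤ r →
      ∃ a : ℕ → ℕ, StrictMono a ∧ (∀ i, 0 < a i) ∧ IsRamseyComplete r a ∧
        ∀ n : ℕ, 1 ≤ n → CountLE a n (C * r * Real.log n ^ 2)) ∧
    (∃ c : ℝ, 0 < c ∧ ∀ r : ℕ, 2 ≤ r →
      ∀ (ι : Type) [Countable ι] (a : ι → ℕ), (∀ i, 0 < a i) →
        (∀ᶠ n : ℕ in atTop, CountLE a n (c * r * Real.log n ^ 2)) →
        ¬ IsRamseyComplete r a) ∧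
    (∀ r : ℕ, 2 ≤ r →
      ∀ (ι : Type) [Countable ι] (a : ι → ℕ), (∀ i, 0 < a i) →
        (∀ᶠ n : ℕ in atTop, CountLE a n (((r : ℝ) - 1) / 140 * Real.logb 2 n ^ 2)) →
        ¬ IsRamseyComplete r a) := by
  refine ⟨⟨_, fun r hr => exists_ramseyComplete hr⟩, ⟨1 / 280, by norm_num, ?_⟩,
    fun r hr ι _ a ha hA => not_isRamseyComplete_of_countLE a ha hr hA⟩
  intro r hr ι _ a ha hA
  refine not_isRamseyComplete_of_countLE a ha hr (hA.mono fun n hn => ⟨hn.1, hn.2.trans ?_⟩)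
  have hr' : (2 : ℝ) ≤ r := by exact_mod_cast hr
  have hlog2 : 0 < Real.log 2 := Real.log_pos (by norm_num)
  have hlog2' : Real.log 2 ≤ 1 := by linarith [Real.log_two_lt_d9]
  have hlog : 0 ≤ Real.log n := Real.log_natCast_nonneg n
  have h1 : Real.log n ≤ Real.logb 2 n := le_div_self hlog hlog2 hlog2'
  -- Here r ≤ 2(r - 1), as r ≥ 2.
  calc 1 / 280 * (r : ℝ) * Real.log n ^ 2 ≤ ((r : ℝ) - 1) / 140 * Real.log n ^ 2 := by
        gcongr
        linarith
    _ ≤ _ := by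
        gcongr
        linarith
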